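/- Let $m\ge 1$, $n\ge 0$, and let $\mathcal M=\{A,B,C,D\}$ with $A\in\mathbb C^{n\times n}$, $B\in\mathbb C^{n\times m}$, $C\in\mathbb C^{m\times n}$, $D\in\mathbb C^{m\times m}$ denote the system $\dot x=Ax+Bu$, $y=Cx+Du$. Assume that $\mathcal M$ is minimal, i.e. $\operatorname{rank}[\,sI_n-A\mid B\,]=n$ and $\operatorname{rank}[\,sI_n-A^{\mathsf H}\mid C^{\mathsf H}\,]=n$ for all $s\in\mathbb C$. For Hermitian matrices $>$ and $\ge$ denote the positive (semi)definite order. A system $\{A,B,C,D\}$ with transfer function $\mathcal T(s)=C(sI_n-A)^{-1}B+D$ is called *passive* if there is a storage function $\mathcal H:\mathbb C^n\to[0,\infty)$ such that $\mathcal H(x(t_1))-\mathcal H(x(t_0))\le\int_{t_0}^{t_1}\operatorname{Re}(y(t)^{\mathsf H}u(t))\,dt$ for all $t_0<t_1$ and all trajectories with locally square-integrable $u$. It is called *strictly passive* if all eigenvalues of $A$ lie in the open left half plane, $\mathcal T(i\omega)^{\mathsf H}+\mathcal T(i\omega)>0$ for all $\omega\in\mathbb R$, and $D^{\mathsf H}+D>0$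 (the condition at $\omega=\infty$). For Hermitian $X\in\mathbb C^{n\times n}$ put $$W(X,\mathcal M)=\begin{bmatrix}-A^{\mathsf H}X-XA & C^{\mathsf H}-XB\\ C-B^{\mathsf H}X & D^{\mathsf H}+D\end{bmatrix}.$$ For $\xi\in\mathbb R$ let $\mathcal M_\xi=\{A+\tfrac{\xi}{2}I_n,\,B,\,C,\,D-\tfrac{\xi}{2}I_m\}$, with transfer function $\mathcal T_\xi$; $\mathcal T_\xi$ is called (strictly) passive if $\mathcal M_\xi$ is. **Theorem.** Suppose that $\mathcal M$ is strictly passive. Then $\Xi:=\sup\{\xi\in\mathbb R\mid \mathcal T_\xi\text{ is strictly passive}\}$ is finite, and 1. $\mathcal T_\Xi$ is passive; 2. there is a Hermitian $X>0$ with $W(X,\mathcal M_\Xi)\ge0$; 3. there is no Hermitian $X$ with $W(X,\mathcal M_\Xi)>0$; 4. for every real $\xi<\Xi$ there is a Hermitian $X>0$ with $W(X,\mathcal M_\xi)>0$; 5. for every Hermitian $X>0$ with $W(X,\mathcal M)\ge0$ the maximum $\xi^*(X):=\max\{\xi\in\mathbb R\mid W(X,\mathcal M)\ge\xi\,\operatorname{diag}(X,I_m)\}$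 exists, and $\Xi$ is the supremum of $\xi^*(X)$ over all such $X$. -/

import Mathlib

open MeasureTheory
open scoped Matrix ComplexOrder

/-- A continuous-time linear time-invariant system `ẋ = A x + B u`, `y = C x + D u` with
`n` states, `m` inputs and `m` outputs, and complex coefficient matrices. -/
structure LTISystem (n m : ℕ) where
  A : Matrix (Fin n) (Fin n) ℂ
  B : Matrix (Fin n) (Fin m) ℂ
  C : Matrix (Fin m) (Fin n) ℂ
  D : Matrix (Fin m) (Fin m) ℂ

/-- `(A, B)` is controllable: `rank [s I - A | B] = n` for every complex `s`. -/
def IsControllablePair {n m : ℕ} (A : Matrix (Fin n) (Fin n) ℂ)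
    (B : Matrix (Fin n) (Fin m) ℂ) : Prop :=
  ∀ s : ℂ, (Matrix.fromCols (s • (1 : Matrix (Fin n) (Fin n) ℂ) - A) B).rank = n

namespace LTISystem

variable {n m : ℕ}

/-- Minimality: `(A, B)` is controllable and `(A, C)` is observable, the latter meaning that
`(Aᴴ, Cᴴ)` is controllable. -/
def IsMinimal (M : LTISystem n m) : Prop :=
  IsControllablePair M.A M.B ∧ IsControllablePair M.Aᴴ M.Cᴴ

/-- The transfer function `T(s) = C (s I - A)⁻¹ B + D`. -/
noncomputable def transfer (M : LTISystem n m) (s : ℂ) : Matrix (Fin m) (Fin m) ℂ :=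
  M.C * (s • (1 : Matrix (Fin n) (Fin n) ℂ) - M.A)⁻¹ * M.B + M.D

/-- `Φ(i ω) = T(i ω)ᴴ + T(i ω)`: the function `Φ` on the imaginary axis. -/
noncomputable def popov (M : LTISystem n m) (ω : ℝ) : Matrix (Fin m) (Fin m) ℂ :=
  (M.transfer (Complex.I * ω))ᴴ + M.transfer (Complex.I * ω)

/-- Asymptotic stability: every eigenvalue of `A` lies in the open left half plane. -/
def IsAsymptoticallyStable (M : LTISystem n m) : Prop :=
  ∀ s ∈ spectrum ℂ M.A, s.re < 0

/-- Strict passivity: asymptotic stability, together with positive definiteness of `Φ` on the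
imaginary axis with the point at infinity, where `Φ(∞) = Dᴴ + D`, included. -/
def IsStrictlyPassive (M : LTISystem n m) : Prop :=
  M.IsAsymptoticallyStable ∧ (∀ ω : ℝ, (M.popov ω).PosDef) ∧ (M.Dᴴ + M.D).PosDef

/-- `(x, u)` is a state/input trajectory: `u` is locally square-integrable and `x` is a
(Caratheodory) solution of `ẋ = A x + B u`. -/
structure IsTrajectory (M : LTISystem n m) (x : ℝ → Fin n → ℂ) (u : ℝ → Fin m → ℂ) : Prop where
  memLp_input : ∀ a b : ℝ, MemLp u 2 (volume.restrict (Set.Icc a b))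
  continuous_state : Continuous x
  state_eq : ∀ a b : ℝ, x b - x a = ∫ t in a..b, (M.A *ᵥ x t + M.B *ᵥ u t)

/-- The output `y = C x + D u`. -/
def output (M : LTISystem n m) (x : ℝ → Fin n → ℂ) (u : ℝ → Fin m → ℂ) (t : ℝ) : Fin m → ℂ :=
  M.C *ᵥ x t + M.D *ᵥ u t

/-- Passivity: there is a nonnegative storage function `V` of the state that satisfies the
dissipation inequality `V (x t₁) - V (x t₀) ≤ ∫ t in t₀..t₁, Re (y(t)ᴴ u(t))`
along all trajectories. -/
def IsPassive (M : LTISystem n m) : Prop :=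
  ∃ V : (Fin n → ℂ) → ℝ, (∀ z, 0 ≤ V z) ∧
    ∀ (x : ℝ → Fin n → ℂ) (u : ℝ → Fin m → ℂ), M.IsTrajectory x u →
      ∀ t₀ t₁ : ℝ, t₀ < t₁ →
        V (x t₁) - V (x t₀) ≤ ∫ t in t₀..t₁, (star (M.output x u t) ⬝ᵥ u t).re

/-- The matrix function `W(X, M)`. -/
def W (M : LTISystem n m) (X : Matrix (Fin n) (Fin n) ℂ) :
    Matrix (Fin n ⊕ Fin m) (Fin n ⊕ Fin m) ℂ :=
  Matrix.fromBlocks (-(M.Aᴴ * X) - X * M.A) (M.Cᴴ - X * M.B)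
    (M.C - M.Bᴴ * X) (M.Dᴴ + M.D)

/-- The set of all `X > 0` with `W(X, M) ≥ 0`. -/
def solSet (M : LTISystem n m) : Set (Matrix (Fin n) (Fin n) ℂ) :=
  {X | X.PosDef ∧ (M.W X).PosSemidef}

/-- The set of all `X > 0` with `W(X, M) > 0`. -/
def strictSolSet (M : LTISystem n m) : Set (Matrix (Fin n) (Fin n) ℂ) :=
  {X | X.PosDef ∧ (M.W X).PosDef}

/-- The shifted model `M_ξ = {A + (ξ/2) I, B, C, D - (ξ/2) I}`. Its transfer function is
`T_ξ(s) = C ((s - ξ/2) I - A)⁻¹ B + (D - (ξ/2) I)`. -/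
noncomputable def shift (M : LTISystem n m) (ξ : ℝ) : LTISystem n m where
  A := M.A + ((ξ / 2 : ℝ) : ℂ) • (1 : Matrix (Fin n) (Fin n) ℂ)
  B := M.B
  C := M.C
  D := M.D - ((ξ / 2 : ℝ) : ℂ) • (1 : Matrix (Fin m) (Fin m) ℂ)

/-- The set of all real `ξ` with `W(X, M) ≥ ξ diag(X, I)`. -/
def xiSet (M : LTISystem n m) (X : Matrix (Fin n) (Fin n) ℂ) : Set ℝ :=
  {ξ : ℝ | (M.W X - (ξ : ℂ) • Matrix.fromBlocks X 0 0 (1 : Matrix (Fin m) (Fin m) ℂ)).PosSemidef}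

/-- `ξ*(X)`, the largest `ξ` with `W(X, M) ≥ ξ diag(X, I)`; that the largest element exists is
asserted separately where `ξ*` is used. -/
noncomputable def xiStar (M : LTISystem n m) (X : Matrix (Fin n) (Fin n) ℂ) : ℝ :=
  sSup (M.xiSet X)

end LTISystem

/-! The pivot is the identity `W(X, M_ξ) = W(X, M) - ξ diag(X, I)` together with the strict
Kalman-Yakubovich-Popov lemma: strict passivity amounts to the existence of `X > 0` with `W(X) > 0`.
Hence `Ξ` is the supremum of the shifts for which the strict matrix inequality is feasible. Since
`diag(X, I) > 0`, feasibility passes to smaller shifts, and a nonstrict solution becomes strict as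
soon as `ξ` decreases. A diagonal entry of `Dᴴ + D` bounds all feasible shifts, so `Ξ` is finite.

The hard half of the lemma is convex duality. An obstruction would be a nonzero `Z ≥ 0` annihilated
by the adjoint of the linear part of `W` and pairing nonpositively with `W(0)`. Such a `Z` is a sum
of rank-one terms `w wᴴ`, `w = (f, g)`, with `f = 0` or `A f + B g = iω f`; on these the form of
`W(0)` is that of `Dᴴ + D` or of `Φ(iω)`, hence positive. Separation then produces a Hermitian `X`,
and Lyapunov's theorem makes it positive definite (`IsStrictlyPassive.dualMap_snd_pos`,
`posDef_of_lyapunov`).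

At `Ξ` itself, controllability bounds the solutions, so solutions for shifts tending to `Ξ` have a
limit point, which observability keeps definite. This limit gives a quadratic storage function and
satisfies `ξ*(X) ≥ Ξ`. A strict solution at `Ξ` would survive a slightly larger shift, a
contradiction. -/

/-! ### Unitary matrices: equal Gram products and diagonalization. -/

namespace Matrix

variable {ι κ : Type*} [Fintype ι] [Fintype κ] [DecidableEq κ]

theorem PosSemidef.exists_eq_conjTranspose_mul_self [DecidableEq ι] {Z : Matrix ι ι ℂ}
    (hZ : Z.PosSemidef) : ∃ G : Matrix ι ι ℂ, Z = Gᴴ * G := by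
  open scoped MatrixOrder in
  exact CStarAlgebra.nonneg_iff_eq_star_mul_self.mp hZ.nonneg

/-- Two factorizations `P Pᴴ = Q Qᴴ` differ by a unitary factor on the right. -/
theorem exists_unitary_of_mul_conjTranspose_eq {P Q : Matrix ι κ ℂ} (h : P * Pᴴ = Q * Qᴴ) :
    ∃ U ∈ unitaryGroup κ ℂ, P = Q * U := by
  classical
  let p := toEuclideanLin Pᴴ
  let q := toEuclideanLin Qᴴ
  have hnorm (x : EuclideanSpace ℂ ι) : ‖p x‖ = ‖q x‖ := by
    have key (R : Matrix ι κ ℂ) : ((‖toEuclideanLin Rᴴ x‖ ^ 2 : ℝ) : ℂ)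
        = star x.ofLp ⬝ᵥ (R * Rᴴ) *ᵥ x.ofLp := by
      have : inner ℂ (toEuclideanLin Rᴴ x) (toEuclideanLin Rᴴ x)
          = ((‖toEuclideanLin Rᴴ x‖ ^ 2 : ℝ) : ℂ) := by
        rw [inner_self_eq_norm_sq_to_K]; simp
      rw [← this, EuclideanSpace.inner_eq_star_dotProduct, ← mulVec_mulVec, dotProduct_mulVec,
        dotProduct_comm]
      simp [star_mulVec]
    have := (key P).trans ((congrArg (fun M => star x.ofLp ⬝ᵥ M *ᵥ x.ofLp) h).trans (key Q).symm)
    exact (sq_eq_sq₀ (norm_nonneg _) (norm_nonneg _)).mp (by exact_mod_cast this)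
  obtain ⟨s, hs⟩ := q.rangeRestrict.exists_rightInverse_of_surjective q.range_rangeRestrict
  have hqs (y : q.range) : q (s y) = y := congrArg Subtype.val (LinearMap.congr_fun hs y)
  -- By equality of norms, `Qᴴ x ↦ Pᴴ x` is a well-defined isometry on the range of `Qᴴ`; in finite
  -- dimension it extends to the whole space.
  let L : q.range →ₗᵢ[ℂ] EuclideanSpace ℂ κ := ⟨p ∘ₗ s, fun y => by
    simp [hnorm, hqs]⟩
  have hL (x : EuclideanSpace ℂ ι) : L.extend (q x) = p x := by
    have h1 := L.extend_apply ⟨q x, x, rfl⟩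
    rw [h1]
    change p (s ⟨q x, x, rfl⟩) = p x
    rw [← sub_eq_zero, ← map_sub, ← norm_eq_zero, hnorm, map_sub, hqs, sub_self, norm_zero]
  let T : Matrix κ κ ℂ := toEuclideanLin.symm L.extend.toLinearMap
  have hT : toEuclideanLin T = L.extend.toLinearMap := by simp [T]
  have hTT : Tᴴ * T = 1 := by
    apply toEuclideanLin.injective
    have hadj : toEuclideanLin Tᴴ = LinearMap.adjoint (toEuclideanLin T) :=
      toEuclideanLin_conjTranspose_eq_adjoint T
    refine LinearMap.ext fun x => ext_inner_left ℂ fun y => ?_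
    have hm : toEuclideanLin (Tᴴ * T) x = toEuclideanLin Tᴴ (toEuclideanLin T x) := by
      simp [toLpLin_apply, mulVec_mulVec]
    rw [hm, hadj, LinearMap.adjoint_inner_right, hT]
    simp
  have hTP : T * Qᴴ = Pᴴ := by
    apply toEuclideanLin.injective
    refine LinearMap.ext fun x => ?_
    have hm : toEuclideanLin (T * Qᴴ) x = toEuclideanLin T (q x) := by
      simp [q, toLpLin_apply, mulVec_mulVec]
    rw [hm, hT]
    exact hL x
  refine ⟨Tᴴ, ?_, ?_⟩
  · rw [mem_unitaryGroup_iff, star_eq_conjTranspose, conjTranspose_conjTranspose, hTT]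
  · rw [← conjTranspose_conjTranspose P, ← hTP, conjTranspose_mul, conjTranspose_conjTranspose]

/-- A unitary matrix is unitarily diagonalizable. -/
theorem exists_unitary_diagonalization {U : Matrix κ κ ℂ} (hU : U ∈ unitaryGroup κ ℂ) :
    ∃ V ∈ unitaryGroup κ ℂ, ∃ d : κ → ℂ, U * V = V * diagonal d := by
  obtain ⟨c, hc, hcU⟩ : ∃ c : ℂ, star c * c = 1 ∧ c ∉ spectrum ℂ U := by
    have hinf : (Metric.sphere (0 : ℂ) 1).Infinite := by
      refine (isPreconnected_sphere (by simp [Complex.rank_real_complex]) 0 1).infinite_of_nontrivial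
        ⟨1, by simp, -1, by simp, fun h => ?_⟩
      have := congrArg Complex.re h
      norm_num at this
    obtain ⟨c, hc, hcU⟩ := hinf.exists_notMem_finite U.finite_spectrum
    refine ⟨c, ?_, hcU⟩
    have : ‖c‖ = 1 := by simpa using hc
    rw [Complex.star_def, Complex.conj_mul', this]; simp
  have hS : IsUnit (c • 1 - U) := by
    have := spectrum.notMem_iff.mp hcU
    rwa [Algebra.algebraMap_eq_smul_one] at this
  set S := c • 1 - U with hSdef
  have hSdet : IsUnit S.det := (isUnit_iff_isUnit_det S).mp hS
  -- Cayley transform with pole `c` off the spectrum: `K` is Hermitian and `(K + i) U = c (K - i)`,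
  -- so an eigenbasis of `K` diagonalizes `U`.
  set K := Complex.I • ((c • 1 + U) * S⁻¹) with hK
  have hUU : Uᴴ * U = 1 := mem_unitaryGroup_iff'.mp hU
  have hKS : K * S = Complex.I • (c • 1 + U) := by
    rw [hK, smul_mul_assoc, Matrix.mul_assoc, nonsing_inv_mul _ hSdet, Matrix.mul_one]
  have hKh : K.IsHermitian := by
    have h1 : Sᴴ * Kᴴ * S = Sᴴ * (K * S) := by
      rw [← conjTranspose_mul, hKS, hSdef]
      simp only [conjTranspose_smul, conjTranspose_add, conjTranspose_sub, conjTranspose_one,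
        Matrix.mul_sub, Matrix.add_mul, Matrix.sub_mul, Matrix.mul_add, smul_mul_assoc,
        mul_smul_comm, Matrix.one_mul, Matrix.mul_one, hUU, smul_sub, smul_add, smul_smul,
        Complex.star_def, Complex.conj_I]
      rw [Complex.star_def] at hc
      rw [map_mul, Complex.conj_I]
      match_scalars
      · linear_combination -2 * Complex.I * hc
      · ring
      · ring
    have h2 : Kᴴ * S = K * S := by
      have hSh : IsUnit Sᴴ := hS.star
      exact hSh.mul_left_cancel (by rw [← Matrix.mul_assoc, h1])
    exact hS.mul_right_cancel h2
  have hcomm : S * U = U * S := by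
    rw [hSdef]; simp [Matrix.sub_mul, Matrix.mul_sub]
  have hKU : (K + Complex.I • 1) * U = c • (K - Complex.I • 1) := by
    apply hS.mul_right_cancel
    rw [Matrix.mul_assoc, ← hcomm, ← Matrix.mul_assoc, Matrix.add_mul, hKS, smul_mul_assoc c,
      Matrix.sub_mul, hKS, hSdef]
    simp only [smul_mul_assoc, Matrix.one_mul, Matrix.add_mul, smul_add, smul_sub, smul_smul]
    simp only [Matrix.sub_mul, smul_mul_assoc, Matrix.one_mul]
    module
  let V : Matrix κ κ ℂ := hKh.eigenvectorUnitary
  have hV : V ∈ unitaryGroup κ ℂ := hKh.eigenvectorUnitary.2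
  have hV1 : Vᴴ * V = 1 := mem_unitaryGroup_iff'.mp hV
  have hV2 : V * Vᴴ = 1 := mem_unitaryGroup_iff.mp hV
  let l : κ → ℂ := fun i => hKh.eigenvalues i
  have hKV : K = V * diagonal l * Vᴴ := by
    conv_lhs => rw [hKh.spectral_theorem, Unitary.conjStarAlgAut_apply]
    rfl
  have hl (i : κ) : l i + Complex.I ≠ 0 := fun h => by
    have := congrArg Complex.im h
    simp [l] at this
  refine ⟨V, hV, fun i => (l i + Complex.I)⁻¹ * (c * (l i - Complex.I)), ?_⟩
  have h3 : (diagonal fun i => l i + Complex.I) * (Vᴴ * U * V)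
      = diagonal fun i => c * (l i - Complex.I) := by
    have ea : (diagonal fun i => l i + Complex.I) = Vᴴ * (K + Complex.I • 1) * V := by
      rw [hKV, Matrix.mul_add, Matrix.add_mul, mul_smul_comm, Matrix.mul_one, smul_mul_assoc, hV1,
        Matrix.mul_assoc V, ← Matrix.mul_assoc Vᴴ, hV1, Matrix.one_mul, Matrix.mul_assoc, hV1,
        Matrix.mul_one, ← diagonal_add, smul_one_eq_diagonal]
    have eb : (diagonal fun i => c * (l i - Complex.I)) = Vᴴ * (c • (K - Complex.I • 1)) * V := by
      rw [hKV, mul_smul_comm, smul_mul_assoc, Matrix.mul_sub, Matrix.sub_mul, mul_smul_comm,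
        Matrix.mul_one, smul_mul_assoc, hV1, Matrix.mul_assoc V, ← Matrix.mul_assoc Vᴴ, hV1,
        Matrix.one_mul, Matrix.mul_assoc, hV1, Matrix.mul_one, smul_one_eq_diagonal, diagonal_sub, ← diagonal_smul]
      rfl
    rw [ea, eb, ← hKU]
    simp only [Matrix.mul_assoc]
    rw [← Matrix.mul_assoc V, hV2, Matrix.one_mul]
  have h4 : Vᴴ * U * V = diagonal fun i => (l i + Complex.I)⁻¹ * (c * (l i - Complex.I)) := by
    ext i j
    have := congrFun (congrFun h3 i) j
    rw [diagonal_mul] at this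
    by_cases hij : i = j
    · subst hij
      rw [diagonal_apply_eq] at this ⊢
      rw [← this, inv_mul_cancel_left₀ (hl i)]
    · rw [diagonal_apply_ne _ hij] at this ⊢
      exact (mul_eq_zero.mp this).resolve_left (hl i)
  rw [← h4, ← Matrix.mul_assoc, ← Matrix.mul_assoc, hV2, Matrix.one_mul]

end Matrix

/-! ### Pairs of factors with skew-Hermitian product. -/

namespace Matrix

section

variable {ι κ : Type*} [Fintype ι] [Fintype κ] [DecidableEq κ]

/-- If `F Hᴴ + H Fᴴ = 0`, then after a unitary change of columns every column of `H` is a purely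
imaginary multiple of that of `F`, or the column of `F` vanishes. -/
theorem exists_unitary_cols_of_skew {F H : Matrix ι κ ℂ} (h : F * Hᴴ + H * Fᴴ = 0) :
    ∃ V ∈ unitaryGroup κ ℂ, ∀ k, (F * V).col k = 0 ∨
      ∃ ω : ℝ, (H * V).col k = (Complex.I * ω) • (F * V).col k := by
  -- The two Gram products differ by `2 (F Hᴴ + H Fᴴ) = 0`. In an eigenbasis of `U`, the columns
  -- satisfy `(d + 1) h = (d - 1) f` with `|d| = 1`.
  obtain ⟨U, hU, hFU⟩ := exists_unitary_of_mul_conjTranspose_eq (P := F + H) (Q := F - H) (by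
    simp only [conjTranspose_add, conjTranspose_sub, Matrix.mul_add, Matrix.add_mul,
      Matrix.mul_sub, Matrix.sub_mul]
    rw [← sub_eq_zero]
    calc _ = (2 : ℂ) • (F * Hᴴ + H * Fᴴ) := by module
      _ = 0 := by rw [h, smul_zero])
  obtain ⟨V, hV, d, hd⟩ := exists_unitary_diagonalization hU
  refine ⟨V, hV, fun k => ?_⟩
  have hnd : star (d k) * d k = 1 := by
    have h1 : (U * V)ᴴ * (U * V) = 1 := mem_unitaryGroup_iff'.mp (mul_mem hU hV)
    rw [hd, conjTranspose_mul, Matrix.mul_assoc, ← Matrix.mul_assoc Vᴴ,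
      ← star_eq_conjTranspose V, mem_unitaryGroup_iff'.mp hV, Matrix.one_mul,
      diagonal_conjTranspose, diagonal_mul_diagonal] at h1
    simpa using congrFun (congrFun h1 k) k
  have hcol : (F * V).col k + (H * V).col k = d k • ((F * V).col k - (H * V).col k) := by
    have h2 : F * V + H * V = (F * V - H * V) * diagonal d := by
      rw [← Matrix.add_mul, hFU, Matrix.mul_assoc, hd, ← Matrix.mul_assoc, Matrix.sub_mul]
    ext i
    have := congrFun (congrFun h2 i) k
    rw [mul_diagonal] at this
    simpa [mul_comm] using this
  set f := (F * V).col k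
  set g := (H * V).col k
  by_cases hd1 : d k + 1 = 0
  · left
    rw [eq_neg_of_add_eq_zero_left hd1] at hcol
    have : (2 : ℂ) • f = 0 := by
      rw [← sub_eq_zero] at hcol
      rw [← hcol]; module
    simpa using this
  · right
    refine ⟨((d k - 1) / (d k + 1)).im, ?_⟩
    have hre : ((d k - 1) / (d k + 1)).re = 0 := by
      rw [Complex.star_def, Complex.ext_iff] at hnd
      simp at hnd
      rw [Complex.div_re, ← add_div, div_eq_zero_iff]
      left
      simp
      linarith [hnd.1]
    have h3 : Complex.I * (((d k - 1) / (d k + 1)).im : ℂ) = (d k - 1) / (d k + 1) := by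
      apply Complex.ext <;> simp [hre]
    rw [h3, div_eq_inv_mul, mul_smul, eq_inv_smul_iff₀ hd1, ← sub_eq_zero]
    rw [← sub_eq_zero] at hcol
    rw [← hcol]; module

end

/-! ### The cone of positive semidefinite matrices. -/

section

variable {ι : Type*} [Fintype ι]

theorem posSemidef_iff_re_nonneg {P : Matrix ι ι ℂ} :
    P.PosSemidef ↔ P.IsHermitian ∧ ∀ v, 0 ≤ (star v ⬝ᵥ P *ᵥ v).re := by
  rw [posSemidef_iff_dotProduct_mulVec]
  refine and_congr_right fun hP => forall_congr' fun v => ?_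
  rw [Complex.le_def]
  simpa using fun _ => (hP.im_star_dotProduct_mulVec_self v).symm

theorem posDef_iff_re_pos {P : Matrix ι ι ℂ} :
    P.PosDef ↔ P.IsHermitian ∧ ∀ v, v ≠ 0 → 0 < (star v ⬝ᵥ P *ᵥ v).re := by
  rw [posDef_iff_dotProduct_mulVec]
  refine and_congr_right fun hP => forall_congr' fun v => forall_congr' fun _ => ?_
  rw [Complex.lt_def]
  simpa using fun _ => (hP.im_star_dotProduct_mulVec_self v).symm

theorem isClosed_setOf_posSemidef : IsClosed {Z : Matrix ι ι ℂ | Z.PosSemidef} := by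
  simp only [posSemidef_iff_re_nonneg, Set.ofPred_and, Set.ofPred_forall]
  refine IsClosed.inter (isClosed_eq (by fun_prop) continuous_id) (isClosed_iInter fun v => ?_)
  exact isClosed_le continuous_const (by fun_prop)

/-- Cauchy-Schwarz for a Gram matrix; it makes trace-bounded parts of the cone compact. -/
theorem PosSemidef.norm_apply_le_trace {Z : Matrix ι ι ℂ} (hZ : Z.PosSemidef) (i j : ι) :
    ‖Z i j‖ ≤ Z.trace.re := by
  classical
  obtain ⟨G, rfl⟩ := hZ.exists_eq_conjTranspose_mul_self
  have htr : (Gᴴ * G).trace.re = ∑ k, ∑ l, ‖G l k‖ ^ 2 := by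
    simp only [trace, diag_apply, mul_apply, conjTranspose_apply, Complex.re_sum]
    refine Finset.sum_congr rfl fun k _ => Finset.sum_congr rfl fun l _ => ?_
    rw [Complex.star_def, Complex.conj_mul']
    norm_cast
  have hle (k : ι) : ∑ l, ‖G l k‖ ^ 2 ≤ (Gᴴ * G).trace.re := by
    rw [htr]
    exact Finset.single_le_sum (f := fun k => ∑ l, ‖G l k‖ ^ 2)
      (fun _ _ => Finset.sum_nonneg fun _ _ => by positivity) (Finset.mem_univ k)
  calc ‖(Gᴴ * G) i j‖ ≤ ∑ l, ‖G l i‖ * ‖G l j‖ := by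
        rw [mul_apply]
        refine (norm_sum_le _ _).trans_eq (Finset.sum_congr rfl fun l _ => ?_)
        simp
    _ ≤ ∑ l, (‖G l i‖ ^ 2 + ‖G l j‖ ^ 2) / 2 :=
        Finset.sum_le_sum fun l _ => by nlinarith [sq_nonneg (‖G l i‖ - ‖G l j‖)]
    _ = (∑ l, ‖G l i‖ ^ 2 + ∑ l, ‖G l j‖ ^ 2) / 2 := by
        rw [← Finset.sum_div, Finset.sum_add_distrib]
    _ ≤ _ := by linarith [hle i, hle j]

theorem isCompact_posSemidef_trace_le (R : ℝ) :
    IsCompact {Z : Matrix ι ι ℂ | Z.PosSemidef ∧ Z.trace.re ≤ R} := by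
  have hc : IsCompact (Set.univ.pi fun _ : ι => Set.univ.pi fun _ : ι =>
      Metric.closedBall (0 : ℂ) R) :=
    isCompact_univ_pi fun _ => isCompact_univ_pi fun _ => isCompact_closedBall 0 R
  refine IsCompact.of_isClosed_subset (X := Matrix ι ι ℂ) hc
    (isClosed_setOf_posSemidef.inter (isClosed_le
      (f := fun Z : Matrix ι ι ℂ => Z.trace.re) (by fun_prop) continuous_const)) ?_
  intro Z hZ i _ j _
  simpa using (hZ.1.norm_apply_le_trace i j).trans hZ.2

/-- The form of `P` has a positive minimum on the compact unit sphere and that of `Q` is bounded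
there; both signs are needed at the supremum `Ξ`. -/
theorem PosDef.exists_pos_add_sub_smul {P Q : Matrix ι ι ℂ} (hP : P.PosDef) (hQ : Q.IsHermitian) :
    ∃ ε : ℝ, 0 < ε ∧ (P + (ε : ℂ) • Q).PosDef ∧ (P - (ε : ℂ) • Q).PosDef := by
  have hK : IsCompact (Metric.sphere (0 : ι → ℂ) 1) := isCompact_sphere 0 1
  obtain ⟨c, hc, hcP⟩ : ∃ c : ℝ, 0 < c ∧
      ∀ v ∈ Metric.sphere (0 : ι → ℂ) 1, c ≤ (star v ⬝ᵥ P *ᵥ v).re := by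
    rcases (Metric.sphere (0 : ι → ℂ) 1).eq_empty_or_nonempty with he | hne
    · exact ⟨1, one_pos, by simp [he]⟩
    · obtain ⟨v, hv, hmin⟩ := hK.exists_isMinOn hne
        (f := fun v : ι → ℂ => (star v ⬝ᵥ P *ᵥ v).re) (by fun_prop)
      refine ⟨_, (posDef_iff_re_pos.mp hP).2 v ?_, fun w hw => hmin hw⟩
      rintro rfl
      simp at hv
  obtain ⟨C, hC⟩ := hK.exists_bound_of_continuousOn
    (f := fun v : ι → ℂ => (star v ⬝ᵥ Q *ᵥ v).re) (by fun_prop)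
  have hC1 : 0 < |C| + 1 := by positivity
  have hbound (v : ι → ℂ) (hv : v ≠ 0) : c / (|C| + 1) * |(star v ⬝ᵥ Q *ᵥ v).re|
      < (star v ⬝ᵥ P *ᵥ v).re := by
    have hv0 : 0 < ‖v‖ := norm_pos_iff.mpr hv
    set w : ι → ℂ := ((‖v‖⁻¹ : ℝ) : ℂ) • v with hw
    have hvw : v = ((‖v‖ : ℝ) : ℂ) • w := by
      rw [hw, smul_smul, ← Complex.ofReal_mul, mul_inv_cancel₀ hv0.ne']; simp
    have hws : w ∈ Metric.sphere (0 : ι → ℂ) 1 := by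
      simp [hw, norm_smul, hv0.ne']
    have hscale (R : Matrix ι ι ℂ) : (star v ⬝ᵥ R *ᵥ v).re
        = ‖v‖ ^ 2 * (star w ⬝ᵥ R *ᵥ w).re := by
      conv_lhs => rw [hvw]
      rw [star_smul, mulVec_smul, smul_dotProduct, dotProduct_smul, smul_smul, smul_eq_mul,
        Complex.star_def, Complex.conj_ofReal, ← Complex.ofReal_mul, Complex.re_ofReal_mul, sq]
    rw [hscale, hscale, abs_mul, abs_of_pos (by positivity : 0 < ‖v‖ ^ 2)]
    have h1 : |(star w ⬝ᵥ Q *ᵥ w).re| ≤ |C| := (hC w hws).trans (le_abs_self C)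
    have h2 : c / (|C| + 1) * |(star w ⬝ᵥ Q *ᵥ w).re| < c := by
      rw [div_mul_eq_mul_div, div_lt_iff₀ hC1]
      nlinarith
    nlinarith [hcP w hws, pow_pos hv0 2]
  have hQe (e : ℝ) : ((e : ℂ) • Q).IsHermitian := by
    rw [IsHermitian, conjTranspose_smul, hQ]; simp
  have hre (e : ℝ) (v : ι → ℂ) : (star v ⬝ᵥ ((e : ℂ) • Q) *ᵥ v).re
      = e * (star v ⬝ᵥ Q *ᵥ v).re := by
    rw [smul_mulVec, dotProduct_smul, smul_eq_mul, Complex.re_ofReal_mul]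
  have he : 0 < c / (|C| + 1) := by positivity
  refine ⟨c / (|C| + 1), he, posDef_iff_re_pos.mpr ⟨hP.1.add (hQe _), fun v hv => ?_⟩,
    posDef_iff_re_pos.mpr ⟨hP.1.sub (hQe _), fun v hv => ?_⟩⟩
  · rw [add_mulVec, dotProduct_add, Complex.add_re, hre]
    nlinarith [hbound v hv, neg_abs_le (star v ⬝ᵥ Q *ᵥ v).re]
  · rw [sub_mulVec, dotProduct_sub, Complex.sub_re, hre]
    nlinarith [hbound v hv, le_abs_self (star v ⬝ᵥ Q *ᵥ v).re]

end

end Matrix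

/-! ### Lyapunov's theorem. -/

namespace Matrix

variable {ι : Type*} [Fintype ι] [DecidableEq ι]

theorem mem_spectrum_of_mulVec_eq_smul {A : Matrix ι ι ℂ} {v : ι → ℂ} {s : ℂ} (hv : v ≠ 0)
    (h : A *ᵥ v = s • v) : s ∈ spectrum ℂ A := by
  rw [spectrum.mem_iff, Algebra.algebraMap_eq_smul_one, isUnit_iff_isUnit_det, isUnit_iff_ne_zero,
    not_not, ← exists_mulVec_eq_zero_iff]
  exact ⟨v, hv, by simp [sub_mulVec, smul_mulVec, h]⟩

theorem exists_mulVec_eq_smul_of_mem_spectrum {A : Matrix ι ι ℂ} {s : ℂ}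
    (h : s ∈ spectrum ℂ A) : ∃ v, v ≠ 0 ∧ A *ᵥ v = s • v := by
  rw [spectrum.mem_iff, Algebra.algebraMap_eq_smul_one, isUnit_iff_isUnit_det, isUnit_iff_ne_zero,
    not_not, ← exists_mulVec_eq_zero_iff] at h
  obtain ⟨v, hv, h⟩ := h
  refine ⟨v, hv, ?_⟩
  simpa [sub_mulVec, smul_mulVec, sub_eq_zero, eq_comm] using h

theorem isUnit_smul_one_sub_of_notMem_spectrum {A : Matrix ι ι ℂ} {s : ℂ}
    (h : s ∉ spectrum ℂ A) : IsUnit (s • 1 - A) := by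
  simpa [Algebra.algebraMap_eq_smul_one] using spectrum.notMem_iff.mp h

open scoped Matrix.Norms.L2Operator in
/-- Powers of a matrix whose eigenvalues lie in the open unit disc tend to zero. -/
theorem tendsto_pow_mulVec_of_spectrum {B : Matrix ι ι ℂ} (hB : ∀ s ∈ spectrum ℂ B, ‖s‖ < 1)
    (v : ι → ℂ) : Filter.Tendsto (fun k : ℕ => (B ^ k) *ᵥ v) Filter.atTop (nhds 0) := by
  rcases isEmpty_or_nonempty ι with hι | hι
  · exact tendsto_const_nhds.congr fun k => Subsingleton.elim _ _
  have hr : spectralRadius ℂ B < 1 := by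
    obtain ⟨s, hs, hs'⟩ := spectrum.exists_nnnorm_eq_spectralRadius B
    rw [← hs']
    exact_mod_cast hB s hs
  obtain ⟨r, hr1, hr2⟩ := exists_between hr
  -- Gelfand's formula gives `‖B ^ k‖ ≤ r ^ k` eventually, with `r < 1`.
  have hev := (spectrum.pow_nnnorm_pow_one_div_tendsto_nhds_spectralRadius B).eventually_lt_const hr1
  lift r to NNReal using (hr2.trans_le le_top).ne
  have hpow : Filter.Tendsto (fun k : ℕ => B ^ k) Filter.atTop (nhds 0) := by
    refine squeeze_zero_norm' (a := fun k => (r : ℝ) ^ k) ?_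
      (tendsto_pow_atTop_nhds_zero_of_lt_one r.2 (by exact_mod_cast hr2))
    filter_upwards [hev, Filter.eventually_gt_atTop 0] with k hk hk0
    have h1 : ((‖B ^ k‖₊ : ENNReal) ^ (1 / (k : ℝ))) ^ (k : ℝ) ≤ (r : ENNReal) ^ (k : ℝ) :=
      ENNReal.rpow_le_rpow hk.le (by positivity)
    rw [← ENNReal.rpow_mul, one_div_mul_cancel (by positivity), ENNReal.rpow_one,
      ENNReal.rpow_natCast] at h1
    exact_mod_cast h1
  have hcont : Continuous fun Z : Matrix ι ι ℂ => Z *ᵥ v := by fun_prop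
  have := (hcont.tendsto 0).comp hpow
  rwa [zero_mulVec] at this

/-- **Lyapunov's theorem**: if all eigenvalues of `A` lie in the open left half plane, a Hermitian
`X` with `Aᴴ X + X A < 0` is positive definite. -/
theorem posDef_of_lyapunov {A X : Matrix ι ι ℂ} (hA : ∀ s ∈ spectrum ℂ A, s.re < 0)
    (hX : X.IsHermitian) (h : (-(Aᴴ * X) - X * A).PosDef) : X.PosDef := by
  have hu : IsUnit (1 - A) := by
    have h1 : (1 : ℂ) ∉ spectrum ℂ A := fun hs => by
      have := hA 1 hs
      norm_num at this
    simpa using isUnit_smul_one_sub_of_notMem_spectrum h1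
  have hdet : IsUnit (1 - A).det := (isUnit_iff_isUnit_det _).mp hu
  -- The Cayley transform sends the left half plane to the unit disc and turns the Lyapunov
  -- inequality into strict decrease of `q` under `B`. As `q (B ^ k v)` decreases to `0`, `q` is
  -- nonnegative, and positive by one more strict step.
  set B : Matrix ι ι ℂ := (1 + A) * (1 - A)⁻¹ with hBdef
  have hBw (w : ι → ℂ) : B *ᵥ ((1 - A) *ᵥ w) = (1 + A) *ᵥ w := by
    rw [mulVec_mulVec, hBdef, Matrix.mul_assoc, nonsing_inv_mul _ hdet, Matrix.mul_one]
  have hex (v : ι → ℂ) : ∃ w, v = (1 - A) *ᵥ w :=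
    ⟨(1 - A)⁻¹ *ᵥ v, by rw [mulVec_mulVec, mul_nonsing_inv _ hdet, one_mulVec]⟩
  have hB : ∀ s ∈ spectrum ℂ B, ‖s‖ < 1 := by
    intro s hs
    obtain ⟨v, hv, hBv⟩ := exists_mulVec_eq_smul_of_mem_spectrum hs
    obtain ⟨w, rfl⟩ := hex v
    rw [hBw] at hBv
    have hw : w ≠ 0 := by rintro rfl; simp at hv
    have hAw : (s + 1) • (A *ᵥ w) = (s - 1) • w := by
      simp only [add_mulVec, sub_mulVec, one_mulVec] at hBv
      rw [← sub_eq_zero] at hBv ⊢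
      rw [← hBv]; module
    have hs1 : s + 1 ≠ 0 := fun h0 => by
      rw [h0, zero_smul, eq_comm, smul_eq_zero] at hAw
      have h1 := hAw.resolve_right hw
      have : (2 : ℂ) = 0 := by linear_combination h0 - h1
      norm_num at this
    have hlt := hA _ (mem_spectrum_of_mulVec_eq_smul hw (s := (s - 1) / (s + 1)) (by
      rw [div_eq_inv_mul, mul_smul, ← hAw, inv_smul_smul₀ hs1]))
    rw [Complex.div_re, ← add_div] at hlt
    have hpos : 0 < Complex.normSq (s + 1) := Complex.normSq_pos.mpr hs1
    rw [div_lt_iff₀ hpos, zero_mul] at hlt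
    simp at hlt
    rw [← sq_lt_one_iff₀ (norm_nonneg s), Complex.sq_norm, Complex.normSq_apply]
    linarith
  set q : (ι → ℂ) → ℝ := fun v => (star v ⬝ᵥ X *ᵥ v).re with hq
  have hstep (v : ι → ℂ) (hv : v ≠ 0) : q (B *ᵥ v) < q v := by
    obtain ⟨w, rfl⟩ := hex v
    have hw : w ≠ 0 := by rintro rfl; simp at hv
    have hpos := (posDef_iff_re_pos.mp h).2 w hw
    have key : star ((1 - A) *ᵥ w) ⬝ᵥ X *ᵥ ((1 - A) *ᵥ w)
        - star ((1 + A) *ᵥ w) ⬝ᵥ X *ᵥ ((1 + A) *ᵥ w)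
        = 2 * (star w ⬝ᵥ (-(Aᴴ * X) - X * A) *ᵥ w) := by
      have e1 : star w ⬝ᵥ Aᴴ *ᵥ X *ᵥ w = star (A *ᵥ w) ⬝ᵥ X *ᵥ w := by
        rw [dotProduct_mulVec, ← star_mulVec]
      simp only [sub_mulVec, add_mulVec, neg_mulVec, one_mulVec, star_sub, star_add, mulVec_sub,
        mulVec_add, sub_dotProduct, add_dotProduct, dotProduct_sub, dotProduct_add,
        dotProduct_neg, e1, ← mulVec_mulVec]
      ring
    have := congrArg Complex.re key
    rw [Complex.sub_re, Complex.mul_re] at this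
    simp only [Complex.re_ofNat, Complex.im_ofNat, zero_mul, sub_zero] at this
    simp only [hq, hBw]
    linarith
  have hanti (v : ι → ℂ) : q (B *ᵥ v) ≤ q v := by
    by_cases hv : v = 0
    · simp [hv]
    · exact (hstep v hv).le
  have hnn (v : ι → ℂ) : 0 ≤ q v := by
    have ha : Antitone fun k : ℕ => q ((B ^ k) *ᵥ v) := antitone_nat_of_succ_le fun k => by
      rw [pow_succ', ← mulVec_mulVec]
      exact hanti _
    have hcont : Continuous q := by fun_prop
    have hlim := (hcont.tendsto 0).comp (tendsto_pow_mulVec_of_spectrum hB v)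
    have hq0 : q 0 = 0 := by simp [hq]
    rw [hq0] at hlim
    simpa using ha.le_of_tendsto hlim 0
  exact posDef_iff_re_pos.mpr ⟨hX, fun v hv => (hnn _).trans_lt (hstep v hv)⟩

end Matrix

/-! ### The dissipation form, and feasibility implies strict passivity. -/

namespace Matrix

variable {ι κ : Type*}

theorem IsHermitian.star_dotProduct_mulVec_comm [Fintype ι] {X : Matrix ι ι ℂ} (hX : X.IsHermitian)
    (f h : ι → ℂ) : star h ⬝ᵥ X *ᵥ f = star (star f ⬝ᵥ X *ᵥ h) := by
  rw [star_dotProduct, star_mulVec, hX.eq, ← dotProduct_mulVec]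

theorem PosDef.toBlocks₁₁ {P : Matrix (ι ⊕ κ) (ι ⊕ κ) ℂ} (hP : P.PosDef) :
    P.toBlocks₁₁.PosDef := hP.submatrix Sum.inl_injective

theorem PosDef.toBlocks₂₂ {P : Matrix (ι ⊕ κ) (ι ⊕ κ) ℂ} (hP : P.PosDef) :
    P.toBlocks₂₂.PosDef := hP.submatrix Sum.inr_injective

end Matrix

namespace LTISystem

open Matrix

variable {n m : ℕ} (M : LTISystem n m)

theorem isHermitian_W {X : Matrix (Fin n) (Fin n) ℂ} (hX : X.IsHermitian) :
    (M.W X).IsHermitian := by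
  rw [W, isHermitian_fromBlocks_iff]
  refine ⟨?_, ?_, ?_, ?_⟩ <;>
    simp only [IsHermitian, conjTranspose_sub, conjTranspose_add, conjTranspose_neg,
      conjTranspose_mul, conjTranspose_conjTranspose, hX.eq] <;> abel

/-- The dissipation form of `W(X, M)`: supply rate minus change of the quadratic storage. -/
theorem star_dotProduct_W_mulVec (X : Matrix (Fin n) (Fin n) ℂ) (f : Fin n → ℂ) (g : Fin m → ℂ) :
    star (Sum.elim f g) ⬝ᵥ M.W X *ᵥ Sum.elim f g
      = star (M.C *ᵥ f + M.D *ᵥ g) ⬝ᵥ g + star g ⬝ᵥ (M.C *ᵥ f + M.D *ᵥ g)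
        - (star (M.A *ᵥ f + M.B *ᵥ g) ⬝ᵥ X *ᵥ f + star f ⬝ᵥ X *ᵥ (M.A *ᵥ f + M.B *ᵥ g)) := by
  have hs : star (Sum.elim f g) = Sum.elim (star f) (star g) := by
    ext i; cases i <;> rfl
  have hadj {p q : ℕ} (R : Matrix (Fin p) (Fin q) ℂ) (v : Fin q → ℂ) (w : Fin p → ℂ) :
      star v ⬝ᵥ Rᴴ *ᵥ w = star (R *ᵥ v) ⬝ᵥ w := by
    rw [dotProduct_mulVec, ← star_mulVec]
  rw [hs, W, fromBlocks_mulVec]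
  simp only [Sum.elim_comp_inl, Sum.elim_comp_inr, sumElim_dotProduct_sumElim, sub_mulVec,
    add_mulVec, neg_mulVec, ← mulVec_mulVec, dotProduct_add, dotProduct_sub, dotProduct_neg, hadj,
    star_add, add_dotProduct, mulVec_add]
  ring

theorem re_star_dotProduct_W_mulVec {X : Matrix (Fin n) (Fin n) ℂ} (hX : X.IsHermitian)
    (f : Fin n → ℂ) (g : Fin m → ℂ) :
    (star (Sum.elim f g) ⬝ᵥ M.W X *ᵥ Sum.elim f g).re
      = 2 * (star (M.C *ᵥ f + M.D *ᵥ g) ⬝ᵥ g).re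
        - 2 * (star f ⬝ᵥ X *ᵥ (M.A *ᵥ f + M.B *ᵥ g)).re := by
  rw [star_dotProduct_W_mulVec, hX.star_dotProduct_mulVec_comm, star_dotProduct g]
  simp only [Complex.sub_re, Complex.add_re, Complex.star_def, Complex.conj_re]
  ring

theorem two_mul_re_output_transfer {ω : ℝ} (g : Fin m → ℂ) :
    2 * (star (M.transfer (Complex.I * ω) *ᵥ g) ⬝ᵥ g).re = (star g ⬝ᵥ M.popov ω *ᵥ g).re := by
  rw [popov, add_mulVec, dotProduct_add, dotProduct_mulVec (star g) _ᴴ, ← star_mulVec,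
    star_dotProduct g]
  simp only [Complex.add_re, Complex.star_def, Complex.conj_re]
  ring

theorem two_mul_re_feedthrough (g : Fin m → ℂ) :
    2 * (star (M.D *ᵥ g) ⬝ᵥ g).re = (star g ⬝ᵥ (M.Dᴴ + M.D) *ᵥ g).re := by
  rw [add_mulVec, dotProduct_add, dotProduct_mulVec (star g) _ᴴ, ← star_mulVec,
    star_dotProduct g]
  simp only [Complex.add_re, Complex.star_def, Complex.conj_re]
  ring

variable {M}

theorem IsAsymptoticallyStable.isUnit (h : M.IsAsymptoticallyStable) (ω : ℝ) :
    IsUnit ((Complex.I * ω) • 1 - M.A) :=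
  isUnit_smul_one_sub_of_notMem_spectrum fun hs => by
    have := h _ hs
    simp at this

/-- The hypothesis says that `(f, g)` is the amplitude of a harmonic motion of frequency `ω`; the
output amplitude is then given by the transfer function. -/
theorem output_eq_transfer {ω : ℝ} (hu : IsUnit ((Complex.I * ω) • 1 - M.A)) {f : Fin n → ℂ}
    {g : Fin m → ℂ} (h : M.A *ᵥ f + M.B *ᵥ g = (Complex.I * ω) • f) :
    f = ((Complex.I * ω) • 1 - M.A)⁻¹ *ᵥ M.B *ᵥ g ∧
      M.C *ᵥ f + M.D *ᵥ g = M.transfer (Complex.I * ω) *ᵥ g := by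
  have hdet := (isUnit_iff_isUnit_det _).mp hu
  have hf : f = ((Complex.I * ω) • 1 - M.A)⁻¹ *ᵥ M.B *ᵥ g := by
    have : M.B *ᵥ g = ((Complex.I * ω) • 1 - M.A) *ᵥ f := by
      rw [sub_mulVec, smul_mulVec, one_mulVec, ← h]; abel
    rw [this, mulVec_mulVec, nonsing_inv_mul _ hdet, one_mulVec]
  refine ⟨hf, ?_⟩
  rw [transfer, add_mulVec]
  conv_lhs => rw [hf]
  simp only [mulVec_mulVec, Matrix.mul_assoc]

/-- Easy half of the strict Kalman--Yakubovich--Popov lemma. -/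
theorem isStrictlyPassive_of_posDef {X : Matrix (Fin n) (Fin n) ℂ} (hX : X.PosDef)
    (hW : (M.W X).PosDef) : M.IsStrictlyPassive := by
  have hstab : M.IsAsymptoticallyStable := by
    intro s hs
    obtain ⟨v, hv, hAv⟩ := exists_mulVec_eq_smul_of_mem_spectrum hs
    -- On `(v, 0)` the form equals `-2 Re(s) vᴴ X v`.
    have h1 := (posDef_iff_re_pos.mp hW).2 (Sum.elim v 0)
      (fun h => hv (funext fun i => congrFun h (Sum.inl i)))
    have h2 := (posDef_iff_re_pos.mp hX).2 v hv
    have h3 := hX.1.im_star_dotProduct_mulVec_self v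
    rw [re_star_dotProduct_W_mulVec M hX.1] at h1
    simp only [mulVec_zero, add_zero, dotProduct_zero, Complex.zero_re, hAv, mulVec_smul,
      dotProduct_smul, smul_eq_mul, Complex.mul_re] at h1
    change Complex.im _ = 0 at h3
    rw [h3] at h1
    nlinarith
  refine ⟨hstab, fun ω => posDef_iff_re_pos.mpr ⟨?_, fun g hg => ?_⟩, ?_⟩
  · exact isHermitian_transpose_add_self _
  · set f := ((Complex.I * ω) • 1 - M.A)⁻¹ *ᵥ M.B *ᵥ g with hf
    have hh : M.A *ᵥ f + M.B *ᵥ g = (Complex.I * ω) • f := by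
      have : ((Complex.I * ω) • 1 - M.A) *ᵥ f = M.B *ᵥ g := by
        rw [hf, mulVec_mulVec, mul_nonsing_inv _ ((isUnit_iff_isUnit_det _).mp (hstab.isUnit ω)),
          one_mulVec]
      rw [← this, sub_mulVec, smul_mulVec, one_mulVec]; abel
    -- The storage term is `Re(iω fᴴ X f) = 0`, so only `gᴴ Φ(iω) g` remains.
    have h1 := (posDef_iff_re_pos.mp hW).2 (Sum.elim f g)
      (fun h => hg (funext fun i => congrFun h (Sum.inr i)))
    have h3 := hX.1.im_star_dotProduct_mulVec_self f
    change Complex.im _ = 0 at h3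
    rw [re_star_dotProduct_W_mulVec M hX.1, (output_eq_transfer (hstab.isUnit ω) hh).2,
      two_mul_re_output_transfer, hh, mulVec_smul, dotProduct_smul] at h1
    simpa [h3] using h1
  · simpa [W] using hW.toBlocks₂₂

end LTISystem

/-! ### Trace duality, and strict passivity implies feasibility. -/

namespace Matrix

theorem conjTranspose_mul_mul_apply_self {ι κ : Type*} [Fintype ι] (S : Matrix ι κ ℂ)
    (P : Matrix ι ι ℂ) (k : κ) : (Sᴴ * P * S) k k = star (S.col k) ⬝ᵥ P *ᵥ S.col k := by
  rw [Matrix.mul_assoc]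
  simp [mul_apply, dotProduct, mulVec]

theorem trace_mul_vecMulVec_star {ι : Type*} [Fintype ι] (P : Matrix ι ι ℂ) (f h : ι → ℂ) :
    (P * vecMulVec h (star f)).trace = star f ⬝ᵥ P *ᵥ h := by
  rw [mul_vecMulVec, trace_vecMulVec, dotProduct_comm]

/-- Real functionals on Hermitian matrices are given by Hermitian matrices via the trace form. -/
theorem exists_isHermitian_trace_repr {ι : Type*} [Fintype ι] [DecidableEq ι]
    (φ : Matrix ι ι ℂ →ₗ[ℝ] ℝ) :
    ∃ X : Matrix ι ι ℂ, X.IsHermitian ∧ ∀ Y : Matrix ι ι ℂ, Y.IsHermitian →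
      φ Y = (X * Y).trace.re := by
  -- The entries are read off from `φ` on `single i j 1` and `single i j I`; passing to the
  -- Hermitian part changes nothing on Hermitian `Y`.
  let X₀ : Matrix ι ι ℂ := fun j i =>
    (φ (single i j (1 : ℂ)) : ℂ) - φ (single i j Complex.I) * Complex.I
  have h₀ (Y : Matrix ι ι ℂ) : φ Y = (X₀ * Y).trace.re := by
    have hsingle (i j : ι) (z : ℂ) : φ (single i j z) = (X₀ j i * z).re := by
      have : single i j z = z.re • single i j (1 : ℂ) + z.im • single i j Complex.I := by
        rw [smul_single, smul_single, ← single_add]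
        congr 1
        apply Complex.ext <;> simp
      rw [this]
      rw [map_add, map_smul, map_smul]
      simp [X₀]
      ring
    conv_lhs => rw [matrix_eq_sum_single Y]
    rw [map_sum]
    rw [trace_mul_comm]
    simp only [trace, diag_apply, mul_apply, Complex.re_sum]
    refine Finset.sum_congr rfl fun i _ => ?_
    rw [map_sum]
    refine Finset.sum_congr rfl fun j _ => ?_
    rw [hsingle]
    rw [mul_comm]
  refine ⟨(2⁻¹ : ℂ) • (X₀ + X₀ᴴ), ?_, fun Y hY => ?_⟩
  · rw [IsHermitian, conjTranspose_smul, (isHermitian_add_transpose_self X₀).eq]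
    simp
  · have h1 : (X₀ᴴ * Y).trace = star (X₀ * Y).trace := by
      rw [← trace_conjTranspose, conjTranspose_mul, hY.eq, trace_mul_comm]
    rw [smul_mul_assoc, trace_smul, Matrix.add_mul, trace_add, h1, h₀ Y, smul_eq_mul,
      Complex.star_def, Complex.add_conj]
    simp

end Matrix

namespace LTISystem

open Matrix

variable {n m : ℕ} (M : LTISystem n m)

/-- The real functional pairing the constant part of `W(X, M)` with `Z`, together with the
adjoint of the linear part of `X ↦ -W(X, M)` evaluated at `Z`. -/
noncomputable def dualMap :
    Matrix (Fin n ⊕ Fin m) (Fin n ⊕ Fin m) ℂ →ₗ[ℝ] Matrix (Fin n) (Fin n) ℂ × ℝ where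
  toFun Z := ((M.A * Z.toBlocks₁₁ + M.B * Z.toBlocks₂₁) +
    (M.A * Z.toBlocks₁₁ + M.B * Z.toBlocks₂₁)ᴴ, (M.W 0 * Z).trace.re)
  map_add' Z Z' := by
    have h1 : (Z + Z').toBlocks₁₁ = Z.toBlocks₁₁ + Z'.toBlocks₁₁ := rfl
    have h2 : (Z + Z').toBlocks₂₁ = Z.toBlocks₂₁ + Z'.toBlocks₂₁ := rfl
    refine Prod.ext ?_ ?_
    · simp only [h1, h2, Matrix.mul_add, conjTranspose_add, Prod.mk_add_mk]
      abel
    · simp [Matrix.mul_add]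
  map_smul' c Z := by
    have h1 : (c • Z).toBlocks₁₁ = c • Z.toBlocks₁₁ := rfl
    have h2 : (c • Z).toBlocks₂₁ = c • Z.toBlocks₂₁ := rfl
    refine Prod.ext ?_ ?_
    · simp only [h1, h2, conjTranspose_add, Matrix.mul_smul, conjTranspose_smul, star_trivial,
        Prod.smul_mk, RingHom.id_apply, smul_add]
    · simp [trace_smul]

theorem continuous_dualMap : Continuous M.dualMap :=
  LinearMap.continuous_of_finiteDimensional M.dualMap

theorem dualMap_vecMulVec_fst (f : Fin n → ℂ) (g : Fin m → ℂ) :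
    (M.dualMap (vecMulVec (Sum.elim f g) (star (Sum.elim f g)))).1
      = vecMulVec (M.A *ᵥ f + M.B *ᵥ g) (star f) + (vecMulVec (M.A *ᵥ f + M.B *ᵥ g) (star f))ᴴ := by
  have h1 : (vecMulVec (Sum.elim f g) (star (Sum.elim f g))).toBlocks₁₁ = vecMulVec f (star f) := rfl
  have h2 : (vecMulVec (Sum.elim f g) (star (Sum.elim f g))).toBlocks₂₁ = vecMulVec g (star f) := rfl
  simp only [dualMap, LinearMap.coe_mk, AddHom.coe_mk, h1, h2, mul_vecMulVec, add_vecMulVec]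

theorem dualMap_vecMulVec_snd (v : Fin n ⊕ Fin m → ℂ) :
    (M.dualMap (vecMulVec v (star v))).2 = (star v ⬝ᵥ M.W 0 *ᵥ v).re := by
  simp only [dualMap, LinearMap.coe_mk, AddHom.coe_mk, trace_mul_vecMulVec_star]

variable {M}

/-- The frequency condition in vector form; the alternative `f = 0` is the point at infinity. -/
theorem IsStrictlyPassive.re_pos_of_eq_smul (hM : M.IsStrictlyPassive) {f : Fin n → ℂ}
    {g : Fin m → ℂ} (hfg : Sum.elim f g ≠ 0)
    (h : f = 0 ∨ ∃ ω : ℝ, M.A *ᵥ f + M.B *ᵥ g = (Complex.I * ω) • f) :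
    0 < (star (Sum.elim f g) ⬝ᵥ M.W 0 *ᵥ Sum.elim f g).re := by
  rw [re_star_dotProduct_W_mulVec M isHermitian_zero]
  simp only [zero_mulVec, dotProduct_zero, Complex.zero_re, mul_zero, sub_zero]
  rcases h with rfl | ⟨ω, h⟩
  · rw [mulVec_zero, zero_add, two_mul_re_feedthrough]
    refine (posDef_iff_re_pos.mp hM.2.2).2 g ?_
    rintro rfl
    exact hfg (funext fun i => by cases i <;> rfl)
  · obtain ⟨hf, hy⟩ := output_eq_transfer (hM.1.isUnit ω) h
    rw [hy, two_mul_re_output_transfer]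
    refine (posDef_iff_re_pos.mp (hM.2.1 ω)).2 g ?_
    rintro rfl
    rw [mulVec_zero, mulVec_zero] at hf
    subst hf
    exact hfg (funext fun i => by cases i <;> rfl)

/-- Absence of a dual obstruction. With `Z = S Sᴴ`, the vanishing first component is a skew relation
between the state rows of `S` and their derivatives, so a unitary change of columns splits `Z` into
harmonic rank-one pieces. -/
theorem IsStrictlyPassive.dualMap_snd_pos (hM : M.IsStrictlyPassive)
    {Z : Matrix (Fin n ⊕ Fin m) (Fin n ⊕ Fin m) ℂ} (hZ : Z.PosSemidef) (hZ0 : Z ≠ 0)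
    (h : (M.dualMap Z).1 = 0) : 0 < (M.dualMap Z).2 := by
  obtain ⟨G, hG⟩ := hZ.exists_eq_conjTranspose_mul_self
  set S := Gᴴ with hS
  have hZS : Z = S * Sᴴ := by rw [hG, hS, conjTranspose_conjTranspose]
  set F := S.toRows₁ with hF
  set N := M.A * F + M.B * S.toRows₂ with hN
  have h11 : Z.toBlocks₁₁ = F * Fᴴ := by rw [hZS]; rfl
  have h21 : Z.toBlocks₂₁ = S.toRows₂ * Fᴴ := by rw [hZS]; rfl
  have hskew : F * Nᴴ + N * Fᴴ = 0 := by
    have h1 : M.A * Z.toBlocks₁₁ + M.B * Z.toBlocks₂₁ = N * Fᴴ := by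
      rw [h11, h21, hN, Matrix.add_mul, Matrix.mul_assoc, Matrix.mul_assoc]
    have h2 : N * Fᴴ + (N * Fᴴ)ᴴ = 0 := by
      rw [← h1]; exact h
    rwa [conjTranspose_mul, conjTranspose_conjTranspose, add_comm] at h2
  obtain ⟨V, hV, hcol⟩ := exists_unitary_cols_of_skew hskew
  have hVV : V * Vᴴ = 1 := mem_unitaryGroup_iff.mp hV
  have hSV : Z = (S * V) * (S * V)ᴴ := by
    rw [conjTranspose_mul, Matrix.mul_assoc, ← Matrix.mul_assoc V, hVV, Matrix.one_mul, hZS]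
  have hsnd : (M.dualMap Z).2
      = ∑ k, (star ((S * V).col k) ⬝ᵥ M.W 0 *ᵥ (S * V).col k).re := by
    change (M.W 0 * Z).trace.re = _
    rw [hSV, ← Matrix.mul_assoc, trace_mul_comm, ← Matrix.mul_assoc, trace, Complex.re_sum]
    exact Finset.sum_congr rfl fun k _ => by rw [diag_apply, conjTranspose_mul_mul_apply_self]
  have hpos (k) (hk : (S * V).col k ≠ 0) :
      0 < (star ((S * V).col k) ⬝ᵥ M.W 0 *ᵥ (S * V).col k).re := by
    have hsplit : (S * V).col k = Sum.elim ((F * V).col k) ((S.toRows₂ * V).col k) := by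
      ext i; cases i <;> rfl
    rw [hsplit] at hk ⊢
    refine hM.re_pos_of_eq_smul hk ((hcol k).imp_right fun ⟨ω, hω⟩ => ⟨ω, ?_⟩)
    rw [← hω, hN, Matrix.add_mul, Matrix.mul_assoc, Matrix.mul_assoc]
    rfl
  obtain ⟨k, hk⟩ : ∃ k, (S * V).col k ≠ 0 := by
    by_contra! hall
    have : S * V = 0 := by ext i k; exact congrFun (hall k) i
    exact hZ0 (by rw [hSV, this, Matrix.zero_mul])
  rw [hsnd]
  refine Finset.sum_pos' (fun j _ => ?_) ⟨k, Finset.mem_univ k, hpos k hk⟩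
  by_cases hj : (S * V).col j = 0
  · simp [hj]
  · exact (hpos j hj).le

/-- Hard half of the strict Kalman--Yakubovich--Popov lemma. -/
theorem IsStrictlyPassive.exists_isHermitian_posDef_W (hm : 0 < m) (hM : M.IsStrictlyPassive) :
    ∃ X : Matrix (Fin n) (Fin n) ℂ, X.IsHermitian ∧ (M.W X).PosDef := by
  set K : Set (Matrix (Fin n ⊕ Fin m) (Fin n ⊕ Fin m) ℂ) := {Z | Z.PosSemidef ∧ Z.trace.re = 1}
  have hKconv : Convex ℝ K := by
    rintro Z ⟨hZ, hZ1⟩ Z' ⟨hZ', hZ1'⟩ a b ha hb hab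
    refine ⟨(hZ.smul ha).add (hZ'.smul hb), ?_⟩
    simp [hZ1, hZ1', hab]
  have hKcomp : IsCompact K := by
    refine (isCompact_posSemidef_trace_le 1).of_isClosed_subset
      (isClosed_setOf_posSemidef.inter (isClosed_eq (f := fun Z :
        Matrix (Fin n ⊕ Fin m) (Fin n ⊕ Fin m) ℂ => Z.trace.re) (by fun_prop) continuous_const))
      fun Z hZ => ⟨hZ.1, hZ.2.le⟩
  have : LocallyConvexSpace ℝ (Matrix (Fin n) (Fin n) ℂ) :=
    inferInstanceAs (LocallyConvexSpace ℝ (Fin n → Fin n → ℂ))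
  -- The image of the compact base of the cone misses the closed ray `{0} × (-∞, 0]`. The separating
  -- `Λ` is negative on this image, and its first component, divided by `-c`, represents the desired
  -- `X`.
  obtain ⟨Λ, u, v, hΛu, huv, hΛv⟩ := geometric_hahn_banach_compact_closed
    (s := M.dualMap '' K) (t := {(0 : Matrix (Fin n) (Fin n) ℂ)} ×ˢ Set.Iic (0 : ℝ))
    (hKconv.linear_image M.dualMap) (hKcomp.image M.continuous_dualMap)
    ((convex_singleton _).prod (convex_Iic _)) (isClosed_singleton.prod isClosed_Iic) (by
      rw [Set.disjoint_left]
      rintro _ ⟨Z, ⟨hZ, hZ1⟩, rfl⟩ ⟨h1, h2⟩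
      refine (hM.dualMap_snd_pos hZ ?_ h1).not_ge h2
      rintro rfl
      simp at hZ1)
  set c : ℝ := Λ (0, 1) with hc
  set φ : Matrix (Fin n) (Fin n) ℂ →ₗ[ℝ] ℝ := Λ.toLinearMap ∘ₗ LinearMap.inl ℝ _ _ with hφ
  have hΛ (p : Matrix (Fin n) (Fin n) ℂ × ℝ) : Λ p = φ p.1 + c * p.2 := by
    have : p = (p.1, 0) + p.2 • (0, 1) := by simp
    conv_lhs => rw [this, map_add, map_smul]
    simp [hφ, hc, mul_comm]
  have hv0 : v < 0 := by
    have := hΛv (0, 0) ⟨rfl, Set.mem_Iic.mpr le_rfl⟩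
    rwa [show ((0 : Matrix (Fin n) (Fin n) ℂ), (0 : ℝ)) = 0 from rfl, map_zero] at this
  have hc0 : c ≤ 0 := by
    by_contra! hcpos
    have := hΛv (0, v / c) ⟨rfl, (div_neg_of_neg_of_pos hv0 hcpos).le⟩
    rw [hΛ] at this
    simp only [map_zero, zero_add, mul_div_cancel₀ _ hcpos.ne'] at this
    exact this.false
  have hneg (w : Fin n ⊕ Fin m → ℂ) (hw : w ≠ 0) : Λ (M.dualMap (vecMulVec w (star w))) < 0 := by
    have hpsd : (vecMulVec w (star w)).PosSemidef := posSemidef_vecMulVec_self_star w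
    have htr : 0 < (vecMulVec w (star w)).trace.re := by
      rw [trace_vecMulVec, ← dotProduct_comm]
      have := (posDef_iff_re_pos.mp (PosDef.one (R := ℂ) (n := Fin n ⊕ Fin m))).2 w hw
      rwa [one_mulVec] at this
    have h1 := hΛu _ ⟨(vecMulVec w (star w)).trace.re⁻¹ • vecMulVec w (star w),
      ⟨hpsd.smul (by positivity), by
        rw [trace_smul, Complex.smul_re, smul_eq_mul, inv_mul_cancel₀ htr.ne']⟩, rfl⟩
    rw [map_smul, map_smul, smul_eq_mul] at h1
    have h2 := h1.trans (huv.trans hv0)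
    exact (pos_iff_neg_of_mul_neg h2).mp (by positivity)
  -- If `c = 0`, then `Λ` vanishes on a test vector with zero state and nonzero input, which exists
  -- because `m > 0`.
  have hc1 : c < 0 := by
    refine hc0.lt_of_ne fun hcz => ?_
    have := hneg (Sum.elim 0 (Pi.single ⟨0, hm⟩ 1)) (fun h => by
      have := congrFun h (Sum.inr ⟨0, hm⟩)
      simp at this)
    rw [hΛ, hcz, zero_mul, add_zero, dualMap_vecMulVec_fst] at this
    simp at this
  obtain ⟨X, hX, hφX⟩ := exists_isHermitian_trace_repr φ
  have hX' : (((-c)⁻¹ : ℝ) • X).IsHermitian := by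
    rw [IsHermitian, conjTranspose_smul, hX.eq, star_trivial]
  refine ⟨((-c)⁻¹ : ℝ) • X, hX', posDef_iff_re_pos.mpr ⟨M.isHermitian_W hX', fun w hw => ?_⟩⟩
  obtain ⟨f, g, rfl⟩ : ∃ f g, w = Sum.elim f g := ⟨w ∘ Sum.inl, w ∘ Sum.inr, by simp⟩
  have h1 := hneg _ hw
  rw [hΛ, dualMap_vecMulVec_snd, dualMap_vecMulVec_fst,
    hφX _ (isHermitian_add_transpose_self _)] at h1
  set h := M.A *ᵥ f + M.B *ᵥ g
  have h2 : (X * (vecMulVec h (star f) + (vecMulVec h (star f))ᴴ)).trace.re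
      = 2 * (star f ⬝ᵥ X *ᵥ h).re := by
    rw [Matrix.mul_add, trace_add, conjTranspose_vecMulVec, star_star, trace_mul_vecMulVec_star,
      trace_mul_vecMulVec_star, hX.star_dotProduct_mulVec_comm, Complex.add_re, Complex.star_def,
      Complex.conj_re]
    ring
  have h3 : (star f ⬝ᵥ (((-c)⁻¹ : ℝ) • X) *ᵥ h).re = (-c)⁻¹ * (star f ⬝ᵥ X *ᵥ h).re := by
    rw [smul_mulVec, dotProduct_smul, Complex.smul_re, smul_eq_mul]
  rw [h2, re_star_dotProduct_W_mulVec M isHermitian_zero] at h1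
  rw [re_star_dotProduct_W_mulVec M hX', h3]
  simp only [zero_mulVec, dotProduct_zero, Complex.zero_re, mul_zero, sub_zero] at h1
  have hcp : 0 < -c := by linarith
  have h4 : (-c)⁻¹ * (star f ⬝ᵥ X *ᵥ h).re < (star (M.C *ᵥ f + M.D *ᵥ g) ⬝ᵥ g).re := by
    rw [inv_mul_lt_iff₀ hcp]
    linarith
  linarith

/-- The strict **Kalman--Yakubovich--Popov lemma**. -/
theorem isStrictlyPassive_iff_strictSolSet_nonempty (hm : 0 < m) :
    M.IsStrictlyPassive ↔ M.strictSolSet.Nonempty := by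
  refine ⟨fun hM => ?_, fun ⟨X, hX, hW⟩ => isStrictlyPassive_of_posDef hX hW⟩
  obtain ⟨X, hX, hW⟩ := hM.exists_isHermitian_posDef_W hm
  exact ⟨X, posDef_of_lyapunov hM.1 hX hW.toBlocks₁₁, hW⟩

end LTISystem

/-! ### A nonstrict solution gives a storage function. -/

/-- A function whose increments are dominated by those of an absolutely continuous function is
absolutely continuous. -/
theorem AbsolutelyContinuousOnInterval.of_dist_le {X Y : Type*} [PseudoMetricSpace X]
    [PseudoMetricSpace Y] {f : ℝ → X} {g : ℝ → Y} {a b K : ℝ}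
    (hg : AbsolutelyContinuousOnInterval g a b)
    (h : ∀ s ∈ Set.uIcc a b, ∀ t ∈ Set.uIcc a b, dist (f s) (f t) ≤ K * dist (g s) (g t)) :
    AbsolutelyContinuousOnInterval f a b := by
  refine squeeze_zero' (.of_forall fun _ => Finset.sum_nonneg fun _ _ => dist_nonneg) ?_
    (by simpa using Filter.Tendsto.const_mul K hg)
  rw [Filter.eventually_inf_principal]
  filter_upwards with E hE
  rw [Finset.mul_sum]
  exact Finset.sum_le_sum fun i hi => h _ (hE.1 i hi).1 _ (hE.1 i hi).2

/-- Chain rule and fundamental theorem of calculus for a `C¹` function along an indefinite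
integral. -/
theorem ContDiff.integral_eq_sub_of_comp_integral {F : Type*} [NormedAddCommGroup F]
    [NormedSpace ℝ F] [FiniteDimensional ℝ F] {φ : F → ℝ} (hφ : ContDiff ℝ 1 φ)
    {x g : ℝ → F} {ψ : ℝ → ℝ} {a b : ℝ} (hx : Continuous x)
    (hg : ∀ c d, IntervalIntegrable g volume c d)
    (hxg : ∀ s t, x t - x s = ∫ r in s..t, g r)
    (hψ : ∀ t, HasDerivAt x (g t) t → HasDerivAt (fun s => φ (x s)) (ψ t) t) :
    ∫ t in a..b, ψ t = φ (x b) - φ (x a) := by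
  have : ProperSpace F := FiniteDimensional.proper ℝ F
  obtain ⟨R, hR⟩ := (isCompact_uIcc (a := a) (b := b)).exists_bound_of_continuousOn hx.continuousOn
  -- The trajectory stays in a ball where `φ` is Lipschitz, so the increments of `φ ∘ x` are
  -- dominated by those of `∫ ‖g‖`.
  obtain ⟨K, hK⟩ := hφ.contDiffOn.exists_lipschitzOnWith (s := Metric.closedBall (0 : F) R)
    one_ne_zero (convex_closedBall 0 R) (isCompact_closedBall 0 R)
  have hmem (s) (hs : s ∈ Set.uIcc a b) : x s ∈ Metric.closedBall (0 : F) R := by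
    simpa using hR s hs
  have hΓ := (hg a b).norm.absolutelyContinuousOnInterval_intervalIntegral (c := a) (by simp)
  have hac : AbsolutelyContinuousOnInterval (fun s => φ (x s)) a b := by
    refine hΓ.of_dist_le (K := K) fun s hs t ht => ?_
    refine (hK.dist_le_mul _ (hmem s hs) _ (hmem t ht)).trans ?_
    gcongr
    rw [dist_comm, dist_eq_norm, hxg, dist_comm, Real.dist_eq,
      intervalIntegral.integral_interval_sub_left (hg a t).norm (hg a s).norm]
    exact intervalIntegral.norm_integral_le_abs_integral_norm
  rw [← hac.integral_deriv_eq_sub]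
  refine intervalIntegral.integral_congr_ae ?_
  filter_upwards [(hg a b).ae_hasDerivAt_integral] with t ht htab
  refine (hψ t ?_).deriv.symm
  have h1 := ht (Set.uIoc_subset_uIcc htab) a (by simp)
  have h2 : x = fun s => x a + ∫ r in a..s, g r := by
    funext s; rw [← hxg]; abel
  rw [h2]
  exact h1.const_add _

namespace LTISystem

open Matrix

variable {n m : ℕ} {M : LTISystem n m}

theorem IsTrajectory.memLp_apply {x : ℝ → Fin n → ℂ} {u : ℝ → Fin m → ℂ}
    (h : M.IsTrajectory x u) (a b : ℝ) (i : Fin m) :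
    MemLp (fun t => u t i) 2 (volume.restrict (Set.uIoc a b)) := by
  have h1 := (h.memLp_input (min a b) (max a b)).mono_measure
    (Measure.restrict_mono (Set.Ioc_subset_Icc_self (a := min a b) (b := max a b)) le_rfl)
  exact h1.continuousLinearMap_comp (ContinuousLinearMap.proj (R := ℝ) i)

theorem IsTrajectory.intervalIntegrable_input {x : ℝ → Fin n → ℂ} {u : ℝ → Fin m → ℂ}
    (h : M.IsTrajectory x u) (a b : ℝ) (i : Fin m) :
    IntervalIntegrable (fun t => u t i) volume a b := by
  rw [intervalIntegrable_iff]
  have : IsFiniteMeasure (volume.restrict (Set.uIoc a b)) := ⟨by simp [Set.uIoc]⟩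
  exact (h.memLp_apply a b i).integrable one_le_two

theorem IsTrajectory.intervalIntegrable_deriv {x : ℝ → Fin n → ℂ} {u : ℝ → Fin m → ℂ}
    (h : M.IsTrajectory x u) (a b : ℝ) :
    IntervalIntegrable (fun t => M.A *ᵥ x t + M.B *ᵥ u t) volume a b := by
  have hx := h.continuous_state
  refine IntervalIntegrable.add (Continuous.intervalIntegrable (by fun_prop) a b) ?_
  rw [intervalIntegrable_iff]
  refine Integrable.of_eval fun i => ?_
  simp only [mulVec, dotProduct]
  exact integrable_finsetSum _ fun j _ =>
    ((intervalIntegrable_iff.mp (h.intervalIntegrable_input a b j)).const_mul (M.B i j))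

/-- The part linear in `u` is continuous times integrable; the quadratic part is a product of two
square-integrable functions. -/
theorem IsTrajectory.intervalIntegrable_supply {x : ℝ → Fin n → ℂ} {u : ℝ → Fin m → ℂ}
    (h : M.IsTrajectory x u) (a b : ℝ) :
    IntervalIntegrable (fun t => (star (M.output x u t) ⬝ᵥ u t).re) volume a b := by
  have hx := h.continuous_state
  have hsplit : (fun t => star (M.output x u t) ⬝ᵥ u t) = fun t =>
      ∑ i, (star ((M.C *ᵥ x t) i) * u t i
        + ∑ j, star (M.D i j) * (star (u t j) * u t i)) := by
    funext t
    simp only [output, dotProduct, Pi.star_apply, Pi.add_apply, star_add, add_mul]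
    refine Finset.sum_congr rfl fun i _ => congrArg _ ?_
    simp [mulVec, dotProduct, Finset.sum_mul, mul_assoc]
  have hC : IntervalIntegrable (fun t => star (M.output x u t) ⬝ᵥ u t) volume a b := by
    rw [hsplit]
    have hsum {k : ℕ} {F : Fin k → ℝ → ℂ} (hF : ∀ i, IntervalIntegrable (F i) volume a b) :
        IntervalIntegrable (fun t => ∑ i, F i t) volume a b := by
      convert! IntervalIntegrable.sum Finset.univ fun i _ => hF i using 1
      ext t
      simp
    refine hsum fun i => IntervalIntegrable.add ?_
      (hsum fun j => IntervalIntegrable.const_mul ?_ _)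
    · exact (h.intervalIntegrable_input a b i).continuousOn_mul
        (Continuous.continuousOn (by fun_prop))
    · rw [intervalIntegrable_iff]
      exact (h.memLp_apply a b j).star.integrable_mul (h.memLp_apply a b i)
  rw [intervalIntegrable_iff] at hC ⊢
  exact hC.re

/-- The storage function is `½ zᴴ X z`: the form of `W` along a trajectory is twice the supply rate
minus twice the derivative of this storage. -/
theorem isPassive_of_posSemidef {X : Matrix (Fin n) (Fin n) ℂ} (hX : X.PosSemidef)
    (hW : (M.W X).PosSemidef) : M.IsPassive := by
  refine ⟨fun z => 2⁻¹ * (star z ⬝ᵥ X *ᵥ z).re, fun z => ?_, fun x u hxu t₀ t₁ ht => ?_⟩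
  · have := (posSemidef_iff_re_nonneg.mp hX).2 z
    positivity
  · have hφ : ContDiff ℝ 1 fun z : Fin n → ℂ => 2⁻¹ * (star z ⬝ᵥ X *ᵥ z).re := by
      simp only [dotProduct, mulVec, Pi.star_apply, Complex.star_def]
      have hconj (i : Fin n) : ContDiff ℝ 1 fun z : Fin n → ℂ => (starRingEnd ℂ) (z i) :=
        Complex.conjCLE.contDiff.comp (contDiff_apply ℝ ℂ i)
      refine contDiff_const.mul (Complex.reCLM.contDiff.comp (ContDiff.sum fun i _ =>
        (hconj i).mul (ContDiff.sum fun j _ => contDiff_const.mul (contDiff_apply ℝ ℂ j))))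
    have hψ (t : ℝ) (hxt : HasDerivAt x (M.A *ᵥ x t + M.B *ᵥ u t) t) :
        HasDerivAt (fun s => 2⁻¹ * (star (x s) ⬝ᵥ X *ᵥ x s).re)
          ((star (x t) ⬝ᵥ X *ᵥ (M.A *ᵥ x t + M.B *ᵥ u t)).re) t := by
      set h := M.A *ᵥ x t + M.B *ᵥ u t
      have hi (i : Fin n) : HasDerivAt (fun s => x s i) (h i) t := hasDerivAt_pi.mp hxt i
      have h1 : HasDerivAt (fun s => star (x s) ⬝ᵥ X *ᵥ x s)
          (star h ⬝ᵥ X *ᵥ x t + star (x t) ⬝ᵥ X *ᵥ h) t := by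
        simp only [dotProduct, mulVec, Pi.star_apply, ← Finset.sum_add_distrib]
        exact HasDerivAt.fun_sum fun i _ => (hi i).star.mul
          (HasDerivAt.fun_sum fun j _ => (hi j).const_mul (X i j))
      have h2 := (Complex.reCLM.hasFDerivAt.comp_hasDerivAt t h1).const_mul (2⁻¹ : ℝ)
      refine h2.congr_deriv ?_
      rw [hX.1.star_dotProduct_mulVec_comm]
      simp only [Complex.reCLM_apply, Complex.add_re, Complex.star_def, Complex.conj_re]
      ring
    have hpt (t : ℝ) : (star (x t) ⬝ᵥ X *ᵥ (M.A *ᵥ x t + M.B *ᵥ u t)).re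
        ≤ (star (M.output x u t) ⬝ᵥ u t).re := by
      have := (posSemidef_iff_re_nonneg.mp hW).2 (Sum.elim (x t) (u t))
      rw [re_star_dotProduct_W_mulVec M hX.1] at this
      rw [output]
      linarith
    rw [← hφ.integral_eq_sub_of_comp_integral hxu.continuous_state hxu.intervalIntegrable_deriv
      (fun s t => hxu.state_eq s t) hψ]
    refine intervalIntegral.integral_mono_on ht.le ?_ (hxu.intervalIntegrable_supply _ _)
      fun t _ => hpt t
    have hd := intervalIntegrable_iff.mp (hxu.intervalIntegrable_deriv t₀ t₁)
    rw [intervalIntegrable_iff]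
    refine Integrable.re (𝕜 := ℂ) ?_
    simp only [dotProduct_mulVec (star _)]
    refine integrable_finsetSum _ fun i _ => ?_
    have hx := hxu.continuous_state
    exact intervalIntegrable_iff.mp ((intervalIntegrable_iff.mpr (hd.eval i)).continuousOn_mul
      (Continuous.continuousOn (by fun_prop)))

end LTISystem

/-! ### Consequences of controllability. -/

open Matrix in
theorem IsControllablePair.exists_eq {n m : ℕ} {A : Matrix (Fin n) (Fin n) ℂ}
    {B : Matrix (Fin n) (Fin m) ℂ} (h : IsControllablePair A B) (s : ℂ) (v : Fin n → ℂ) :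
    ∃ a b, s • a - A *ᵥ a + B *ᵥ b = v := by
  have htop : (fromCols (s • (1 : Matrix (Fin n) (Fin n) ℂ) - A) B).mulVecLin.range = ⊤ :=
    Submodule.eq_top_of_finrank_eq (by simpa [Matrix.rank] using h s)
  obtain ⟨w, hw⟩ := LinearMap.range_eq_top.mp htop v
  refine ⟨w ∘ Sum.inl, w ∘ Sum.inr, ?_⟩
  rw [← hw, mulVecLin_apply, fromCols_mulVec, sub_mulVec, smul_mulVec, one_mulVec]

open Matrix in
/-- For a controllable pair the only `A`-invariant subspace that contains the range of `B` is the
whole space. -/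
theorem IsControllablePair.eq_top_of_invariant {n m : ℕ} {A : Matrix (Fin n) (Fin n) ℂ}
    {B : Matrix (Fin n) (Fin m) ℂ} (h : IsControllablePair A B) (U : Submodule ℂ (Fin n → ℂ))
    (hA : ∀ v ∈ U, A *ᵥ v ∈ U) (hB : ∀ g, B *ᵥ g ∈ U) : U = ⊤ := by
  by_contra hU
  have : Nontrivial ((Fin n → ℂ) ⧸ U) := Submodule.Quotient.nontrivial_iff.mpr hU
  set T : Module.End ℂ ((Fin n → ℂ) ⧸ U) := U.mapQ U A.mulVecLin fun v hv => hA v hv with hT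
  obtain ⟨s, hs⟩ := Module.End.exists_eigenvalue T
  obtain ⟨q, hq⟩ := hs.exists_hasEigenvector
  -- The range of `B` dies in the quotient, so the rank condition makes `s - T` surjective, hence
  -- injective, contrary to the eigenvector.
  have hsurj : Function.Surjective (s • (1 : Module.End ℂ ((Fin n → ℂ) ⧸ U)) - T) := by
    intro r
    obtain ⟨v, rfl⟩ := U.mkQ_surjective r
    obtain ⟨a, b, rfl⟩ := h.exists_eq s v
    refine ⟨U.mkQ a, ?_⟩
    have hb : U.mkQ (B *ᵥ b) = 0 := by simpa using hB b
    rw [map_add, hb]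
    simp [hT]
    rfl
  refine hq.2 (LinearMap.injective_iff_surjective.mpr hsurj (a₁ := q) (a₂ := 0) ?_)
  rw [map_zero, LinearMap.sub_apply, hq.apply_eq_smul]
  simp

/-! ### Shifted inequalities: monotonicity, definiteness and boundedness of solutions. -/

namespace LTISystem

open Matrix

variable {n m : ℕ} {M : LTISystem n m}

theorem W_shift (ξ : ℝ) (X : Matrix (Fin n) (Fin n) ℂ) :
    (M.shift ξ).W X
      = M.W X - (ξ : ℂ) • fromBlocks X 0 0 (1 : Matrix (Fin m) (Fin m) ℂ) := by
  have h2 : (ξ : ℂ) = ((ξ / 2 : ℝ) : ℂ) + ((ξ / 2 : ℝ) : ℂ) := by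
    rw [← Complex.ofReal_add, add_halves]
  rw [W, W, shift, fromBlocks_smul, sub_eq_add_neg (fromBlocks _ _ _ _), fromBlocks_neg,
    fromBlocks_add, h2]
  congr 1
  · simp only [conjTranspose_add, conjTranspose_smul, conjTranspose_one, Matrix.add_mul,
      Matrix.mul_add, smul_mul_assoc, mul_smul_comm, Matrix.one_mul, Matrix.mul_one,
      Complex.star_def, Complex.conj_ofReal]
    module
  · simp
  · simp
  · simp only [conjTranspose_sub, conjTranspose_smul, conjTranspose_one, Complex.star_def,
      Complex.conj_ofReal]
    module

theorem mem_xiSet {X : Matrix (Fin n) (Fin n) ℂ} {ξ : ℝ} :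
    ξ ∈ M.xiSet X ↔ ((M.shift ξ).W X).PosSemidef := by
  rw [W_shift]; rfl

theorem W_shift_zero (X : Matrix (Fin n) (Fin n) ℂ) : (M.shift 0).W X = M.W X := by
  simp [W_shift]

theorem W_shift_eq_add (ξ ξ' : ℝ) (X : Matrix (Fin n) (Fin n) ℂ) :
    (M.shift ξ').W X = (M.shift ξ).W X
      + (ξ - ξ') • fromBlocks X 0 0 (1 : Matrix (Fin m) (Fin m) ℂ) := by
  rw [W_shift, W_shift, ← Complex.coe_smul, Complex.ofReal_sub]
  module

theorem posSemidef_fromBlocks_one {X : Matrix (Fin n) (Fin n) ℂ} (hX : X.PosSemidef) :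
    (fromBlocks X 0 0 (1 : Matrix (Fin m) (Fin m) ℂ)).PosSemidef := by
  obtain ⟨G, rfl⟩ := hX.exists_eq_conjTranspose_mul_self
  have := posSemidef_conjTranspose_mul_self
    (fromBlocks G 0 0 (1 : Matrix (Fin m) (Fin m) ℂ))
  simpa [fromBlocks_conjTranspose, fromBlocks_multiply] using this

theorem posDef_fromBlocks_one {X : Matrix (Fin n) (Fin n) ℂ} (hX : X.PosDef) :
    (fromBlocks X 0 0 (1 : Matrix (Fin m) (Fin m) ℂ)).PosDef := by
  rw [(posSemidef_fromBlocks_one hX.posSemidef).posDef_iff_det_ne_zero, det_fromBlocks_zero₂₁,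
    det_one, mul_one]
  exact hX.det_pos.ne'

theorem posSemidef_W_shift_mono {X : Matrix (Fin n) (Fin n) ℂ} (hX : X.PosSemidef) {ξ ξ' : ℝ}
    (h : ξ' ≤ ξ) (hW : ((M.shift ξ).W X).PosSemidef) : ((M.shift ξ').W X).PosSemidef := by
  rw [W_shift_eq_add ξ]
  exact hW.add ((posSemidef_fromBlocks_one hX).smul (sub_nonneg.mpr h))

theorem posDef_W_shift_of_lt {X : Matrix (Fin n) (Fin n) ℂ} (hX : X.PosDef) {ξ ξ' : ℝ}
    (h : ξ' < ξ) (hW : ((M.shift ξ).W X).PosSemidef) : ((M.shift ξ').W X).PosDef := by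
  rw [W_shift_eq_add ξ]
  exact PosDef.posSemidef_add hW ((posDef_fromBlocks_one hX).smul (sub_pos.mpr h))

/-- The input block of `W` does not involve `X`, so the bound is uniform in `X`. -/
theorem le_re_of_posSemidef_W_shift (hm : 0 < m) {X : Matrix (Fin n) (Fin n) ℂ} {ξ : ℝ}
    (hW : ((M.shift ξ).W X).PosSemidef) : ξ ≤ ((M.Dᴴ + M.D) ⟨0, hm⟩ ⟨0, hm⟩).re := by
  have := hW.diag_nonneg (i := Sum.inr ⟨0, hm⟩)
  rw [W_shift] at this
  have := (Complex.le_def.mp this).1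
  simp [W] at this
  simpa using this

theorem continuous_W : Continuous M.W := by
  have h : Continuous fun X : Matrix (Fin n) (Fin n) ℂ =>
      fromBlocks (-(M.Aᴴ * X) - X * M.A) (M.Cᴴ - X * M.B) (M.C - M.Bᴴ * X) (M.Dᴴ + M.D) :=
    Continuous.matrix_fromBlocks (by fun_prop) (by fun_prop) (by fun_prop) (by fun_prop)
  exact h

theorem isGreatest_xiStar (hm : 0 < m) {X : Matrix (Fin n) (Fin n) ℂ} (hX : X ∈ M.solSet) :
    IsGreatest (M.xiSet X) (M.xiStar X) := by
  have hcl : IsClosed (M.xiSet X) :=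
    isClosed_setOf_posSemidef.preimage (f := fun ξ : ℝ =>
      M.W X - (ξ : ℂ) • fromBlocks X 0 0 (1 : Matrix (Fin m) (Fin m) ℂ)) (by fun_prop)
  have hbdd : BddAbove (M.xiSet X) :=
    ⟨_, fun ξ hξ => le_re_of_posSemidef_W_shift hm (mem_xiSet.mp hξ)⟩
  have hne : (M.xiSet X).Nonempty := ⟨0, mem_xiSet.mpr (by rw [W_shift_zero]; exact hX.2)⟩
  exact ⟨hcl.csSup_mem hne hbdd, fun ξ hξ => le_csSup hbdd hξ⟩

/-- The form vanishes at `(v, 0)`, and semidefiniteness turns this into `W (v, 0) = 0`. Thus `ker X`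
is `A`-invariant and contained in `ker C`. -/
theorem mulVec_eq_zero_of_posSemidef_W {X : Matrix (Fin n) (Fin n) ℂ} (hX : X.IsHermitian)
    (hW : (M.W X).PosSemidef) {v : Fin n → ℂ} (hv : X *ᵥ v = 0) :
    X *ᵥ M.A *ᵥ v = 0 ∧ M.C *ᵥ v = 0 := by
  have h0 : star (Sum.elim v (0 : Fin m → ℂ)) ⬝ᵥ M.W X *ᵥ Sum.elim v 0 = 0 := by
    have h1 : star v ⬝ᵥ X *ᵥ M.A *ᵥ v = 0 := by
      rw [hX.star_dotProduct_mulVec_comm, hv, dotProduct_zero, star_zero]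
    rw [star_dotProduct_W_mulVec]
    simp only [mulVec_zero, add_zero, hv, h1, dotProduct_zero, star_zero, zero_dotProduct, sub_zero]
  rw [hW.dotProduct_mulVec_zero_iff, W, fromBlocks_mulVec] at h0
  simp only [Sum.elim_comp_inl, Sum.elim_comp_inr, mulVec_zero, add_zero, sub_mulVec, neg_mulVec,
    ← mulVec_mulVec, hv, neg_zero, zero_sub, sub_zero] at h0
  exact ⟨neg_eq_zero.mp (funext fun i => congrFun h0 (Sum.inl i)),
    funext fun i => congrFun h0 (Sum.inr i)⟩

/-- Observability makes every positive semidefinite solution of `W(X, M) ≥ 0` definite. -/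
theorem posDef_of_isControllablePair_conjTranspose (hobs : IsControllablePair M.Aᴴ M.Cᴴ)
    {X : Matrix (Fin n) (Fin n) ℂ} (hX : X.PosSemidef) (hW : (M.W X).PosSemidef) :
    X.PosDef := by
  set U := LinearMap.ker X.mulVecLin with hU
  have hUX (v) : v ∈ U ↔ X *ᵥ v = 0 := by simp [hU]
  have hbot : U = ⊥ := by
    by_contra hne
    have : Nontrivial U := Submodule.nontrivial_iff_ne_bot.mpr hne
    have hinv : ∀ v ∈ U, M.A.mulVecLin v ∈ U := fun v hv =>
      (hUX _).mpr (mulVec_eq_zero_of_posSemidef_W hX.1 hW ((hUX v).mp hv)).1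
    obtain ⟨s, hs⟩ := Module.End.exists_eigenvalue (M.A.mulVecLin.restrict hinv)
    obtain ⟨⟨v, hvU⟩, hv⟩ := hs.exists_hasEigenvector
    have hAv : M.A *ᵥ v = s • v := congrArg Subtype.val hv.apply_eq_smul
    have hCv := (mulVec_eq_zero_of_posSemidef_W hX.1 hW ((hUX v).mp hvU)).2
    -- Pairing this expansion of `v` with the eigenvector `v ∈ ker C` makes all terms cancel, so `vᴴ
    -- v = 0`.
    obtain ⟨a, b, hab⟩ := hobs.exists_eq (star s) v
    have h0 : star v ⬝ᵥ v = 0 := by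
      conv_lhs => rw [← hab]
      conv_lhs => enter [1]; rw [hab]
      rw [dotProduct_add, dotProduct_sub, dotProduct_mulVec, dotProduct_mulVec, ← star_mulVec,
        ← star_mulVec, hAv, hCv]
      simp
    exact hv.2 (Subtype.ext (dotProduct_star_self_eq_zero.mp h0))
  rw [hX.posDef_iff_det_ne_zero]
  intro hdet
  obtain ⟨v, hv, hXv⟩ := exists_mulVec_eq_zero_iff.mpr hdet
  have := (hUX v).mpr hXv
  rw [hbot] at this
  exact hv this

/-- Controllability bounds the positive semidefinite solutions of `W(X, M) ≥ 0`. -/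
theorem exists_trace_le_of_isControllablePair (hctr : IsControllablePair M.A M.B) :
    ∃ R : ℝ, ∀ X : Matrix (Fin n) (Fin n) ℂ, X.PosSemidef → (M.W X).PosSemidef →
      X.trace.re ≤ R := by
  by_contra! hcon
  choose X hX hW htr using fun j : ℕ => hcon (j + 1)
  have hpos (j : ℕ) : 0 < (X j).trace.re := by
    have := htr j
    have := Nat.cast_nonneg (α := ℝ) j
    linarith
  -- Dropping `C` and `D` leaves the linear part of `W`, which governs the limit `Z` of the
  -- solutions scaled to trace one. Its zero input block forces `Z B = 0`, so `ker Z` is invariant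
  -- and contains the range of `B`; then `Z = 0`, contradicting trace one.
  set M₀ : LTISystem n m := ⟨M.A, M.B, 0, 0⟩
  have hM₀ (c : ℝ) (Z : Matrix (Fin n) (Fin n) ℂ) : M₀.W (c • Z) = c • M.W Z - c • M.W 0 := by
    simp only [W, M₀, fromBlocks_smul, sub_eq_add_neg (fromBlocks _ _ _ _), fromBlocks_neg,
      fromBlocks_add]
    congr 1 <;> simp [sub_eq_add_neg]
  set Y : ℕ → Matrix (Fin n) (Fin n) ℂ := fun j => (X j).trace.re⁻¹ • X j
  have hY1 (j : ℕ) : (Y j).trace.re = 1 := by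
    simp only [Y, trace_smul, Complex.smul_re, smul_eq_mul, inv_mul_cancel₀ (hpos j).ne']
  have hYmem (j : ℕ) : Y j ∈ {Z : Matrix (Fin n) (Fin n) ℂ | Z.PosSemidef ∧ Z.trace.re ≤ 1} :=
    ⟨(hX j).smul (inv_nonneg.mpr (hpos j).le), (hY1 j).le⟩
  have : FirstCountableTopology (Matrix (Fin n) (Fin n) ℂ) :=
    inferInstanceAs (FirstCountableTopology (Fin n → Fin n → ℂ))
  obtain ⟨Z, hZ, φ, hφ, hlim⟩ := (isCompact_posSemidef_trace_le 1).tendsto_subseq hYmem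
  have hZ1 : Z.trace.re = 1 := by
    have hc : Continuous fun Z : Matrix (Fin n) (Fin n) ℂ => Z.trace.re := by fun_prop
    refine tendsto_nhds_unique ((hc.tendsto Z).comp hlim) ?_
    exact tendsto_const_nhds.congr fun k => (hY1 _).symm
  have hinv : Filter.Tendsto (fun j => (X j).trace.re⁻¹) Filter.atTop (nhds 0) := by
    refine tendsto_inv_atTop_zero.comp (Filter.tendsto_atTop_mono (fun j => ?_)
      tendsto_natCast_atTop_atTop)
    linarith [htr j]
  have hWZ : (M₀.W Z).PosSemidef := by
    have h1 : Filter.Tendsto (fun k => M₀.W (Y (φ k)) + (X (φ k)).trace.re⁻¹ • M.W 0)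
        Filter.atTop (nhds (M₀.W Z + (0 : ℝ) • M.W 0)) :=
      ((continuous_W.tendsto Z).comp hlim).add ((hinv.comp hφ.tendsto_atTop).smul_const _)
    rw [zero_smul, add_zero] at h1
    refine isClosed_setOf_posSemidef.mem_of_tendsto h1 (.of_forall fun k => ?_)
    simp only [Y, hM₀, sub_add_cancel]
    exact (hW _).smul (inv_nonneg.mpr (hpos _).le)
  have htop : LinearMap.ker Z.mulVecLin = ⊤ := by
    refine hctr.eq_top_of_invariant _ (fun v hv => ?_) fun g => ?_
    · have hv' : Z *ᵥ v = 0 := by simpa using hv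
      simpa using (mulVec_eq_zero_of_posSemidef_W hZ.1.1 hWZ hv').1
    · have h0 : star (Sum.elim (0 : Fin n → ℂ) g) ⬝ᵥ M₀.W Z *ᵥ Sum.elim 0 g = 0 := by
        rw [star_dotProduct_W_mulVec]
        simp [M₀]
      rw [hWZ.dotProduct_mulVec_zero_iff, W, fromBlocks_mulVec] at h0
      have h1 := funext fun i => congrFun h0 (Sum.inl i)
      simp [M₀] at h1
      have h2 : (-(Z * M.B)) *ᵥ g = 0 := h1
      simpa [neg_mulVec] using h2
  have hZ0 : Z = 0 := by
    ext i j
    have : Pi.single j 1 ∈ LinearMap.ker Z.mulVecLin := htop ▸ Submodule.mem_top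
    simpa using congrFun (LinearMap.mem_ker.mp this) i
  simp [hZ0] at hZ1

end LTISystem

/-! ### Attainment and failure of strictness at the supremum. -/

namespace LTISystem

open Matrix

variable {n m : ℕ} {M : LTISystem n m}

theorem strictSolSet_shift_mono {ξ ξ' : ℝ} (h : ξ' ≤ ξ) :
    (M.shift ξ).strictSolSet ⊆ (M.shift ξ').strictSolSet := by
  rintro X ⟨hX, hW⟩
  rcases h.eq_or_lt with rfl | h
  · exact ⟨hX, hW⟩
  · exact ⟨hX, posDef_W_shift_of_lt hX h hW.posSemidef⟩

/-- For a minimal system the supremum of the strictly feasible shifts is feasible. -/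
theorem solSet_shift_nonempty_of_isLUB (hmin : M.IsMinimal) {Ξ : ℝ}
    (hΞ : IsLUB {ξ : ℝ | (M.shift ξ).strictSolSet.Nonempty} Ξ)
    (h0 : (M.shift 0).strictSolSet.Nonempty) : (M.shift Ξ).solSet.Nonempty := by
  have hΞ0 : 0 ≤ Ξ := hΞ.1 h0
  obtain ⟨ξ, -, -, hξ, hmem⟩ := hΞ.exists_seq_monotone_tendsto ⟨0, h0⟩
  -- With nonnegative shifts, all `X k` also solve the unshifted inequality, to which the single
  -- trace bound for `M` applies.
  have hmem' (k : ℕ) : (M.shift (max (ξ k) 0)).strictSolSet.Nonempty := by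
    rcases max_choice (ξ k) 0 with h | h <;> rw [h]
    exacts [hmem k, h0]
  choose X hX hW using hmem'
  have hξ' : Filter.Tendsto (fun k => max (ξ k) 0) Filter.atTop (nhds Ξ) := by
    simpa [max_eq_left hΞ0] using hξ.max (tendsto_const_nhds (x := (0 : ℝ)))
  obtain ⟨R, hR⟩ := exists_trace_le_of_isControllablePair hmin.1
  have : FirstCountableTopology (Matrix (Fin n) (Fin n) ℂ) :=
    inferInstanceAs (FirstCountableTopology (Fin n → Fin n → ℂ))
  obtain ⟨Z, hZ, φ, hφ, hlim⟩ := (isCompact_posSemidef_trace_le R).tendsto_subseq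
    fun k => ⟨(hX k).posSemidef, hR _ (hX k).posSemidef (by
      rw [← W_shift_zero]
      exact posSemidef_W_shift_mono (hX k).posSemidef (le_max_right _ _) (hW k).posSemidef)⟩
  have hWZ : ((M.shift Ξ).W Z).PosSemidef := by
    have hc : Continuous fun p : ℝ × Matrix (Fin n) (Fin n) ℂ => (M.shift p.1).W p.2 := by
      simp only [W_shift]
      exact (continuous_W.comp continuous_snd).sub
        (Continuous.smul (Complex.continuous_ofReal.comp continuous_fst)
        (continuous_snd.matrix_fromBlocks continuous_const continuous_const continuous_const))
    exact isClosed_setOf_posSemidef.mem_of_tendsto ((hc.tendsto (Ξ, Z)).comp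
      ((hξ'.comp hφ.tendsto_atTop).prodMk_nhds hlim)) (.of_forall fun k => (hW _).posSemidef)
  refine ⟨Z, posDef_of_isControllablePair_conjTranspose hmin.2 hZ.1 ?_, hWZ⟩
  rw [← W_shift_zero]
  exact posSemidef_W_shift_mono hZ.1 hΞ0 hWZ

/-- At the supremum of the strictly passive shifts the strict linear matrix inequality has no
Hermitian solution, since strict feasibility persists under small shifts. -/
theorem not_posDef_W_of_isLUB {Ξ : ℝ} (hΞ : IsLUB {ξ : ℝ | (M.shift ξ).IsStrictlyPassive} Ξ)
    (hlt : ∀ ξ < Ξ, (M.shift ξ).IsStrictlyPassive) {X : Matrix (Fin n) (Fin n) ℂ}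
    (hX : X.IsHermitian) : ¬ ((M.shift Ξ).W X).PosDef := by
  intro hW
  have hE : (fromBlocks X 0 0 (1 : Matrix (Fin m) (Fin m) ℂ)).IsHermitian :=
    IsHermitian.fromBlocks hX (by simp) isHermitian_one
  obtain ⟨ε, hε, h1, h2⟩ := hW.exists_pos_add_sub_smul hE
  -- `X` is only Hermitian so far. Stability is known below `Ξ`, where Lyapunov's theorem yields `X
  -- > 0`; the same `X` then certifies the shift `Ξ + ε`.
  have hminus : ((M.shift (Ξ - ε)).W X).PosDef := by
    rwa [W_shift_eq_add Ξ, sub_sub_cancel, ← Complex.coe_smul]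
  have hplus : ((M.shift (Ξ + ε)).W X).PosDef := by
    rwa [W_shift_eq_add Ξ, sub_add_cancel_left, neg_smul, ← sub_eq_add_neg, ← Complex.coe_smul]
  have hXpos : X.PosDef :=
    posDef_of_lyapunov (hlt (Ξ - ε) (by linarith)).1 hX hminus.toBlocks₁₁
  have := hΞ.1 (isStrictlyPassive_of_posDef hXpos hplus)
  linarith

end LTISystem

theorem mainTheorem4 {n m : ℕ} (hm : 0 < m) (M : LTISystem n m)
    (hmin : M.IsMinimal) (hM : M.IsStrictlyPassive) :
    ∃ Ξ : ℝ,
      IsLUB {ξ : ℝ | (M.shift ξ).IsStrictlyPassive} Ξ ∧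
      (M.shift Ξ).IsPassive ∧
      (M.shift Ξ).solSet.Nonempty ∧
      (¬ ∃ X : Matrix (Fin n) (Fin n) ℂ, X.IsHermitian ∧ ((M.shift Ξ).W X).PosDef) ∧
      (∀ ξ : ℝ, ξ < Ξ → (M.shift ξ).strictSolSet.Nonempty) ∧
      (∀ X ∈ M.solSet, IsGreatest (M.xiSet X) (M.xiStar X)) ∧
      IsLUB (M.xiStar '' M.solSet) Ξ := by
  have hS (ξ : ℝ) := LTISystem.isStrictlyPassive_iff_strictSolSet_nonempty (M := M.shift ξ) hm
  have h0 : (M.shift 0).strictSolSet.Nonempty := by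
    obtain ⟨X, hX, hW⟩ := (LTISystem.isStrictlyPassive_iff_strictSolSet_nonempty hm).mp hM
    exact ⟨X, hX, by rwa [LTISystem.W_shift_zero]⟩
  obtain ⟨Ξ, hΞ⟩ : ∃ Ξ, IsLUB {ξ : ℝ | (M.shift ξ).IsStrictlyPassive} Ξ :=
    Real.exists_isLUB ⟨0, (hS 0).mpr h0⟩ ⟨_, fun ξ hξ => by
      obtain ⟨X, -, hW⟩ := (hS ξ).mp hξ
      exact LTISystem.le_re_of_posSemidef_W_shift hm hW.posSemidef⟩
  have hlt (ξ : ℝ) (h : ξ < Ξ) : (M.shift ξ).strictSolSet.Nonempty := by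
    obtain ⟨ξ', hξ', h1, -⟩ := hΞ.exists_between h
    exact ((hS ξ').mp hξ').mono (LTISystem.strictSolSet_shift_mono h1.le)
  have hΞ0 : 0 ≤ Ξ := hΞ.1 ((hS 0).mpr h0)
  obtain ⟨X, hX, hW⟩ := LTISystem.solSet_shift_nonempty_of_isLUB hmin
    (by simpa only [hS] using hΞ) h0
  have hgreatest (Y) (hY : Y ∈ M.solSet) := LTISystem.isGreatest_xiStar hm hY
  refine ⟨Ξ, hΞ, LTISystem.isPassive_of_posSemidef hX.posSemidef hW, ⟨X, hX, hW⟩, ?_, hlt,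
    hgreatest, ?_, fun b hb => ?_⟩
  · rintro ⟨Y, hY, hWY⟩
    exact LTISystem.not_posDef_W_of_isLUB hΞ (fun ξ h => (hS ξ).mpr (hlt ξ h)) hY hWY
  · rintro _ ⟨Y, hY, rfl⟩
    -- Only nonstrict feasibility holds at `ξ*(Y)` itself, so the comparison with `Ξ` goes through
    -- all smaller shifts.
    refine le_of_forall_lt_imp_le_of_dense fun ξ h => hΞ.1 ((hS ξ).mpr ⟨Y, hY.1, ?_⟩)
    exact LTISystem.posDef_W_shift_of_lt hY.1 h (LTISystem.mem_xiSet.mp (hgreatest Y hY).1)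
  · have hXM : X ∈ M.solSet := ⟨hX, by
      rw [← LTISystem.W_shift_zero]
      exact LTISystem.posSemidef_W_shift_mono hX.posSemidef hΞ0 hW⟩
    -- The limit solution at `Ξ` attains the supremum: `Ξ` lies in its `xiSet`.
    exact ((hgreatest X hXM).2 (LTISystem.mem_xiSet.mpr hW)).trans (hb ⟨X, hXM, rfl⟩)
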